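/- Let $n\ge 2$ be odd and let $n$ agents have reduced attitudes $\Gamma_1,\dots,\Gamma_n\in\mathcal S^2=\{x\in\mathbb R^3:\|x\|=1\}$, with indices read modulo $n$. Write $\hat x y=x\times y$, and let $\mathcal N_i=\{i-1,i+1\}$ (undirected ring). Consider the closed-loop system on $(\mathcal S^2)^n$ $$\dot\Gamma_i=\hat\Gamma_i\sum_{j\in\mathcal N_i}\hat\Gamma_i\Gamma_j,\qquad i=1,\dots,n .$$ Let $\theta_{ij}=\arccos(\Gamma_i^T\Gamma_j)$ be the geodesic distance, equip $(\mathcal S^2)^n$ with the maximum of the geodesic distances of the components, and let $d_{\mathcal M}$ be the distance to a set $\mathcal M$. Let $\mathcal D$ be the set of all equilibria; its connected components are called the equilibrium manifolds. A set $\mathcal M$ is stable if for every $\varepsilon>0$ there is $\delta>0$ such that every trajectory $\mathbf\Gamma$ with $d_{\mathcal M}(\mathbf\Gamma(0))<\delta$ satisfies $d_{\mathcal M}(\mathbf\Gamma(t))<\varepsilon$ for all $t\ge0$; it is asymptotically stable if moreover $d_{\mathcal M}(\mathbf\Gamma(t))\to0$ for all trajectories starting sufficiently close to $\mathcal M$.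 Let $$\mathcal M_o=\{\mathbf\Gamma:\ \Gamma_i=\exp\big((i-1)(\pi-\pi/n)\hat u\big)v\ \ \forall i,\ \ u,v\in\mathcal S^2,\ u^Tv=0\}.$$ Then: 1. For every trajectory $\mathbf\Gamma$ there is an equilibrium manifold $\mathcal M$ with $d_{\mathcal M}(\mathbf\Gamma(t))\to0$ as $t\to\infty$. Each equilibrium manifold is a single orbit of the diagonal action of $SO(3)$ on $(\mathcal S^2)^n$. 2. $\mathcal M_o$ is an equilibrium manifold and it is asymptotically stable. No other equilibrium manifold is stable. 3. Every equilibrium $\mathbf\Gamma^*\in\mathcal D\setminus\mathcal M_o$ is unstable (the set $\{\mathbf\Gamma^*\}$ is not stable). Moreover $\Gamma_1^*,\dots,\Gamma_n^*$ lie on a great circle, so that some rotation in $SO(3)$ takes each $\Gamma_i^*$ to a point $(\cos\psi_i^*,\sin\psi_i^*,0)^T$ of the equator. For every such rotation and angles, write the system in the coordinates $\Gamma_i=(\cos\psi_i\cos\varphi_i,\sin\psi_i\cos\varphi_i,\sin\varphi_i)^T$, that is, $$\dot\psi_i=-\frac{1}{\cos\varphi_i}\sum_{j\in\mathcal N_i}\sin(\psi_j-\psi_i)\cos\varphi_j,\qquad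 \dot\varphi_i=\sum_{j\in\mathcal N_i}\big[\sin\varphi_i\cos\varphi_j\cos(\psi_i-\psi_j)-\cos\varphi_i\sin\varphi_j\big],$$ and let $A_\psi$ and $A_\varphi$ be the matrices of partial derivatives at $(\psi^*,0)$ of the right-hand sides of the $\psi$-equations with respect to the $\psi_j$, and of the $\varphi$-equations with respect to the $\varphi_j$. If the distances $\theta^*_{i,i+1}$ are not all equal, then $x^TA_\psi x>0$ for some $x\in\mathbb R^n$. If $\theta^*_{i,i+1}=\alpha$ for all $i$, then the eigenvalues of $A_\varphi$, with multiplicity, are $$\lambda_l=2\big[\cos\alpha-\cos((l-1)2\pi/n)\big],\qquad l=1,\dots,n,$$ and $2[\cos\alpha-\cos(\pi-\pi/n)]>0$. -/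

import Mathlib

open Real Set Filter Topology Polynomial

noncomputable section

namespace RingFormation

/-- Euclidean three-space. -/
abbrev E3 : Type := EuclideanSpace ℝ (Fin 3)

/-- The unit 2-sphere, the space of reduced attitudes. -/
abbrev S2 : Type := Metric.sphere (0 : E3) 1

/-- The state space `(S²)ⁿ`. Agents are indexed by `Fin n` (so agent `i : Fin n` is the agent
with number `i + 1` in one-based numbering), and arithmetic on `Fin n` is modulo `n`. -/
abbrev State (n : ℕ) : Type := Fin n → S2

/-- The hat operator: the skew-symmetric matrix of `y ↦ x × y`. -/
def hat (x : E3) : Matrix (Fin 3) (Fin 3) ℝ :=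
  !![0, -x 2, x 1; x 2, 0, -x 0; -x 1, x 0, 0]

/-- Matrix acting on a vector of Euclidean three-space. -/
def act (A : Matrix (Fin 3) (Fin 3) ℝ) (y : E3) : E3 := WithLp.toLp 2 (A.mulVec y.ofLp)

theorem act_hat (x y : E3) :
    act (hat x) y = WithLp.toLp 2 (crossProduct x.ofLp y.ofLp) := by
  ext i
  fin_cases i <;> simp [act, hat, crossProduct, dotProduct, Fin.sum_univ_three] <;>
    ring

/-! ### Distances -/

/-- The geodesic distance `θ` on the sphere, with values in `[0, π]`. -/
def geoDist (x y : S2) : ℝ := Real.arccos (inner ℝ (x : E3) (y : E3))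

/-- The maximum metric on `(S²)ⁿ` built from the geodesic distance. -/
def stateDist {n : ℕ} (Γ Γ' : State n) : ℝ := ⨆ i, geoDist (Γ i) (Γ' i)

/-- The distance from a state to a (nonempty) set of states. -/
def setDist {n : ℕ} (M : Set (State n)) (Γ : State n) : ℝ := ⨅ Γ' : M, stateDist Γ (Γ' : State n)

/-! ### The closed-loop system -/

/-- The neighbour sets of the undirected ring: `N_i = {i - 1, i + 1}` modulo `n`. -/
def undirectedRing (n : ℕ) [NeZero n] (i : Fin n) : Finset (Fin n) := {i - 1, i + 1}

/-- The control law `ω_i = - ∑_{j ∈ N_i} Γ̂_i Γ_j`. -/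
def control {n : ℕ} (N : Fin n → Finset (Fin n)) (Γ : State n) (i : Fin n) : E3 :=
  -∑ j ∈ N i, act (hat (Γ i)) (Γ j)

/-- The closed-loop velocity of agent `i`: the kinematics `ω̂_i Γ_i` under the control law. -/
def velocity {n : ℕ} (N : Fin n → Finset (Fin n)) (Γ : State n) (i : Fin n) : E3 :=
  act (hat (control N Γ i)) (Γ i)

/-- A trajectory of the closed-loop system on `[0, ∞)` (values at negative times are ignored). -/
def IsTrajectory {n : ℕ} (N : Fin n → Finset (Fin n)) (Γ : ℝ → State n) : Prop :=
  ∀ t : ℝ, 0 ≤ t → ∀ i : Fin n,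
    HasDerivWithinAt (fun s => (Γ s i : E3)) (velocity N (Γ t) i) (Ici 0) t

/-- The set of all equilibria of the closed-loop system. -/
def equilibriumSet {n : ℕ} (N : Fin n → Finset (Fin n)) : Set (State n) :=
  {Γ | ∀ i, velocity N Γ i = 0}

/-- The equilibrium manifolds: the connected components of the equilibrium set. -/
def IsEquilibriumManifold {n : ℕ} (N : Fin n → Finset (Fin n)) (M : Set (State n)) : Prop :=
  ∃ Γ ∈ equilibriumSet N, M = connectedComponentIn (equilibriumSet N) Γ

/-- The trajectory approaches the set `M` as time tends to infinity. -/
def Approaches {n : ℕ} (Γ : ℝ → State n) (M : Set (State n)) : Prop :=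
  Tendsto (fun t => setDist M (Γ t)) atTop (𝓝 0)

/-- Lyapunov stability of a (nonempty) set of states. -/
def IsStable {n : ℕ} (N : Fin n → Finset (Fin n)) (M : Set (State n)) : Prop :=
  ∀ ε : ℝ, 0 < ε → ∃ δ : ℝ, 0 < δ ∧ ∀ Γ : ℝ → State n, IsTrajectory N Γ →
    setDist M (Γ 0) < δ → ∀ t : ℝ, 0 ≤ t → setDist M (Γ t) < ε

/-- Asymptotic stability of a (nonempty) set of states: stable and locally attractive. -/
def IsAsymptoticallyStable {n : ℕ} (N : Fin n → Finset (Fin n)) (M : Set (State n)) : Prop :=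
  IsStable N M ∧ ∃ δ : ℝ, 0 < δ ∧ ∀ Γ : ℝ → State n, IsTrajectory N Γ →
    setDist M (Γ 0) < δ → Approaches Γ M

/-! ### The cyclic formation -/

/-- The cyclic formation manifold `M_o`: consecutive agents differ by the rotation through
`π - π/n` about a common axis `u` orthogonal to all of them. -/
def cyclicFormation (n : ℕ) : Set (State n) :=
  {Γ | ∃ u v : S2, inner ℝ (u : E3) (v : E3) = 0 ∧ ∀ i : Fin n,
    (Γ i : E3) = act (NormedSpace.exp ((((i : ℕ) : ℝ) * (π - π / n)) • hat (u : E3))) (v : E3)}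

/-! ### Rotations and the linearization in spherical coordinates -/

/-- The orbit of a state under the simultaneous rotation of all agents by `SO(3)`. -/
def rotationOrbit {n : ℕ} (Γ : State n) : Set (State n) :=
  {Γ' | ∃ R ∈ Matrix.specialOrthogonalGroup (Fin 3) ℝ, ∀ i, (Γ' i : E3) = act R (Γ i)}

/-- The point of the sphere with yaw angle `ψ` and elevation `φ`. -/
def sphericalPoint (ψ φ : ℝ) : E3 := !₂[cos ψ * cos φ, sin ψ * cos φ, sin φ]

/-- The rotation `R` brings all agents to the equator, agent `i` to the yaw angle `ψ i`. -/
def RotatesToEquator {n : ℕ} (R : Matrix (Fin 3) (Fin 3) ℝ) (Γ : State n) (ψ : Fin n → ℝ) : Prop :=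
  R ∈ Matrix.specialOrthogonalGroup (Fin 3) ℝ ∧ ∀ i, act R (Γ i) = sphericalPoint (ψ i) 0

/-- Right-hand side of the `ψ`-equation of the closed-loop system in spherical coordinates. -/
def psiField {n : ℕ} (N : Fin n → Finset (Fin n)) (ψ φ : Fin n → ℝ) (i : Fin n) : ℝ :=
  (-∑ j ∈ N i, sin (ψ j - ψ i) * cos (φ j)) / cos (φ i)

/-- Right-hand side of the `φ`-equation of the closed-loop system in spherical coordinates. -/
def phiField {n : ℕ} (N : Fin n → Finset (Fin n)) (ψ φ : Fin n → ℝ) (i : Fin n) : ℝ :=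
  ∑ j ∈ N i, (sin (φ i) * cos (φ j) * cos (ψ i - ψ j) - cos (φ i) * sin (φ j))

/-- The `ψ`-Jacobian at the point `(ψ, 0)`: the partial derivatives of the `ψ`-equations with
respect to the angles `ψ_j`. -/
def psiJacobian {n : ℕ} (N : Fin n → Finset (Fin n)) (ψ : Fin n → ℝ) : Matrix (Fin n) (Fin n) ℝ :=
  Matrix.of fun i j => deriv (fun s => psiField N (Function.update ψ j s) 0 i) (ψ j)

/-- The `φ`-Jacobian at the point `(ψ, 0)`: the partial derivatives of the `φ`-equations with
respect to the angles `φ_j`. -/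
def phiJacobian {n : ℕ} (N : Fin n → Finset (Fin n)) (ψ : Fin n → ℝ) : Matrix (Fin n) (Fin n) ℝ :=
  Matrix.of fun i j => deriv (fun s => phiField N ψ (Function.update 0 j s) i) 0

end RingFormation

end

open RingFormation

namespace RingFormation

/-! ### Coordinates and the cross product -/

/-! The system is the negative gradient flow on `(S²)ⁿ` of V = ∑ Γ_i · Γ_{i+1}: the velocity of
agent i is minus the tangential part of the sum of its two neighbours, so V' = -∑ ‖Γ_i'‖²
(`sum_inner_velocity`). Everything follows from the critical points of V and its values there; the
instability proofs use descent of V and no linearization theorem.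

At an equilibrium the neighbour sum is parallel to Γ_i, hence Γ_i × Γ_{i+1} does not depend on i
(`cross_const`). All agents therefore lie on one great circle and the edge cosines agree up to sign.
In angles on that circle the increments have a common sine and sum to zero. Each is ±θ modulo π, and
an odd number of signs cannot cancel, so θ is a rational multiple of π with bounded denominator:
only finitely many edge-cosine vectors occur (`finite_edgeCos_image`). Such a vector determines the
equilibrium up to rotation through a two-step recursion. Since SO(3) is connected, the components of
the equilibrium set are exactly the orbits, and there are finitely many, all compact.

A trajectory has bounded speed and V is bounded below, so it approaches the equilibrium set; its
tail is connected and the orbits are separated, so it approaches a single orbit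
(`exists_limit_orbit`).

The spectrum of a circulant matrix gives V ≥ n cos(π - π/n), with equality exactly on
`cyclicFormation` (`mem_cyclicFormation_iff_potential`). Being the strict minimum set, it is
asymptotically stable. At any other equilibrium the second variation of V takes a negative value:
along the great circle if some edge cosine is positive, and otherwise normal to it, where all edge
cosines are equal (`exists_potential_lt`). Arbitrarily near there are then states of smaller V,
whose trajectories must end on a different orbit (`not_isStable`). -/

theorem inner_eq_coords (x y : E3) :
    inner ℝ x y = x 0 * y 0 + x 1 * y 1 + x 2 * y 2 := by
  simp [PiLp.inner_apply, Fin.sum_univ_three, mul_comm]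

theorem ext_coords {x y : E3} (h0 : x 0 = y 0) (h1 : x 1 = y 1) (h2 : x 2 = y 2) : x = y := by
  ext i; fin_cases i <;> assumption

theorem act_apply_coords (A : Matrix (Fin 3) (Fin 3) ℝ) (y : E3) (i : Fin 3) :
    act A y i = A i 0 * y 0 + A i 1 * y 1 + A i 2 * y 2 := by
  simp [act, Matrix.mulVec, dotProduct, Fin.sum_univ_three]

/-- The cross product of Euclidean three-space. -/
noncomputable def cross (x y : E3) : E3 := act (hat x) y

@[simp] theorem cross_apply_zero (x y : E3) : cross x y 0 = x 1 * y 2 - x 2 * y 1 := by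
  simp [cross, act_apply_coords, hat]; ring

@[simp] theorem cross_apply_one (x y : E3) : cross x y 1 = x 2 * y 0 - x 0 * y 2 := by
  simp [cross, act_apply_coords, hat]; ring

@[simp] theorem cross_apply_two (x y : E3) : cross x y 2 = x 0 * y 1 - x 1 * y 0 := by
  simp [cross, act_apply_coords, hat]; ring

theorem act_mul (A B : Matrix (Fin 3) (Fin 3) ℝ) (y : E3) : act (A * B) y = act A (act B y) := by
  simp [act, Matrix.mulVec_mulVec]

@[simp] theorem act_one (y : E3) : act 1 y = y := by
  simp [act]

theorem act_add (A : Matrix (Fin 3) (Fin 3) ℝ) (x y : E3) : act A (x + y) = act A x + act A y := by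
  simp [act, Matrix.mulVec_add]

theorem act_sub (A : Matrix (Fin 3) (Fin 3) ℝ) (x y : E3) : act A (x - y) = act A x - act A y := by
  simp [act, Matrix.mulVec_sub]

theorem act_smul (A : Matrix (Fin 3) (Fin 3) ℝ) (c : ℝ) (x : E3) : act A (c • x) = c • act A x := by
  simp [act, Matrix.mulVec_smul]

theorem continuous_act :
    Continuous fun p : Matrix (Fin 3) (Fin 3) ℝ × E3 => act p.1 p.2 := by
  unfold act
  fun_prop

@[simp] theorem inner_self_sphere (x : S2) : inner ℝ (x : E3) (x : E3) = 1 := by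
  rw [real_inner_self_eq_norm_sq, norm_eq_of_mem_sphere]; norm_num

theorem coords_sphere (x : S2) : (x : E3) 0 ^ 2 + (x : E3) 1 ^ 2 + (x : E3) 2 ^ 2 = 1 := by
  have := inner_self_sphere x
  rw [inner_eq_coords] at this
  linarith

/-- A vector of unit square length as a point of the sphere. -/
def unitOf (x : E3) (h : inner ℝ x x = 1) : S2 :=
  ⟨x, by
    rw [real_inner_self_eq_norm_sq] at h
    rw [mem_sphere_zero_iff_norm]
    nlinarith [norm_nonneg x]⟩

theorem inner_cross_left (x y : E3) : inner ℝ x (cross x y) = 0 := by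
  rw [inner_eq_coords]; simp; ring

theorem inner_cross_right (x y : E3) : inner ℝ y (cross x y) = 0 := by
  rw [inner_eq_coords]; simp; ring

theorem inner_cross_cross (x y z w : E3) :
    inner ℝ (cross x y) (cross z w) = inner ℝ x z * inner ℝ y w - inner ℝ x w * inner ℝ y z := by
  simp only [inner_eq_coords, cross_apply_zero, cross_apply_one, cross_apply_two]; ring

theorem cross_cross (x y z : E3) :
    cross x (cross y z) = inner ℝ x z • y - inner ℝ x y • z := by
  apply ext_coords <;> simp [inner_eq_coords] <;> ring

theorem cross_add_right (x y z : E3) : cross x (y + z) = cross x y + cross x z :=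
  act_add _ _ _

theorem cross_smul_right (x y : E3) (c : ℝ) : cross x (c • y) = c • cross x y :=
  act_smul _ _ _

theorem cross_swap (x y : E3) : cross x y = -cross y x := by
  apply ext_coords <;> simp <;> ring

theorem cross_self (x : E3) : cross x x = 0 := by
  apply ext_coords <;> simp <;> ring

/-- Every unit vector has an orthogonal unit vector. -/
theorem exists_orthogonal_unit (x : S2) : ∃ v : S2, inner ℝ (x : E3) (v : E3) = 0 := by
  have hx := coords_sphere x
  by_cases h : (x : E3) 0 ^ 2 + (x : E3) 1 ^ 2 = 0
  · refine ⟨unitOf !₂[1, 0, 0] (by rw [inner_eq_coords]; simp), ?_⟩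
    have h0 : (x : E3) 0 = 0 := by nlinarith [sq_nonneg ((x : E3) 0), sq_nonneg ((x : E3) 1)]
    simp [unitOf, inner_eq_coords, h0]
  · set r := √((x : E3) 0 ^ 2 + (x : E3) 1 ^ 2) with hr
    have hr2 : r ^ 2 = (x : E3) 0 ^ 2 + (x : E3) 1 ^ 2 := Real.sq_sqrt (by positivity)
    have hr0 : r ≠ 0 := by intro h0; apply h; rw [← hr2, h0]; norm_num
    refine ⟨unitOf !₂[-(x : E3) 1 / r, (x : E3) 0 / r, 0] ?_, ?_⟩
    · rw [inner_eq_coords]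
      simp
      field_simp
      linarith
    · simp [unitOf, inner_eq_coords]
      ring

/-! ### Cyclic induction -/

theorem cyclic_induction {n : ℕ} [NeZero n] {P : Fin n → Prop} (h0 : P 0)
    (hs : ∀ i, P i → P (i + 1)) (i : Fin n) : P i := by
  obtain ⟨k, hk⟩ := i
  induction k with
  | zero => exact h0
  | succ k ih =>
    have := hs _ (ih (by omega))
    convert this using 1
    apply Fin.ext
    simp [Fin.val_add, Nat.mod_eq_of_lt hk]

theorem sum_add_one {n : ℕ} [NeZero n] {M : Type*} [AddCommMonoid M] (f : Fin n → M) :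
    ∑ i, f (i + 1) = ∑ i, f i :=
  Equiv.sum_comp (Equiv.addRight 1) f

/-- For n ≤ 2 the two neighbours coincide and the set {i - 1, i + 1} collapses to one element; from
n = 3 on, sums over it have two terms. -/
theorem sub_one_ne_add_one {n : ℕ} [NeZero n] (hn : 3 ≤ n) (i : Fin n) : i - 1 ≠ i + 1 := by
  intro h
  have h2 : (1 : Fin n) + 1 = 0 := by
    have : i - 1 + 1 + (1 + 1) = i - 1 + 1 := by
      rw [← add_assoc, sub_add_cancel, ← h, sub_add_cancel]
    simpa using this
  have := congrArg Fin.val h2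
  rw [Fin.val_add, Fin.val_one', Nat.mod_eq_of_lt (by omega : 1 < n),
    Nat.mod_eq_of_lt (by omega)] at this
  simp at this

theorem sum_undirectedRing {n : ℕ} [NeZero n] (hn : 3 ≤ n) {M : Type*} [AddCommMonoid M]
    (f : Fin n → M) (i : Fin n) : ∑ j ∈ undirectedRing n i, f j = f (i - 1) + f (i + 1) :=
  Finset.sum_pair (sub_one_ne_add_one hn i)

/-! ### The velocity field -/

/-- The sum of the two neighbours of an agent. -/
noncomputable def neighbourSum {n : ℕ} [NeZero n] (Γ : State n) (i : Fin n) : E3 :=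
  (Γ (i - 1) : E3) + (Γ (i + 1) : E3)

/-- By the triple product identity the velocity is minus the projection of the neighbour sum to the
tangent plane at Γ_i, which exhibits the gradient structure. -/
theorem velocity_eq {n : ℕ} [NeZero n] (hn : 3 ≤ n) (Γ : State n) (i : Fin n) :
    velocity (undirectedRing n) Γ i =
      inner ℝ (Γ i : E3) (neighbourSum Γ i) • (Γ i : E3) - neighbourSum Γ i := by
  have hx := inner_self_sphere (Γ i)
  have h1 : control (undirectedRing n) Γ i = -cross (Γ i) (neighbourSum Γ i) := by
    unfold control neighbourSum
    rw [sum_undirectedRing hn, cross_add_right]; rfl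
  rw [velocity, h1]
  change cross (-cross (Γ i : E3) (neighbourSum Γ i)) (Γ i) = _
  have h2 := cross_cross (Γ i : E3) (Γ i) (neighbourSum Γ i)
  rw [hx, one_smul] at h2
  rw [← h2]
  apply ext_coords <;> simp <;> ring

/-- The inner product of consecutive agents. -/
noncomputable def edgeCos {n : ℕ} [NeZero n] (Γ : State n) (i : Fin n) : ℝ :=
  inner ℝ (Γ i : E3) (Γ (i + 1) : E3)

theorem inner_neighbourSum {n : ℕ} [NeZero n] (Γ : State n) (i : Fin n) :
    inner ℝ (Γ i : E3) (neighbourSum Γ i) = edgeCos Γ (i - 1) + edgeCos Γ i := by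
  simp [neighbourSum, edgeCos, inner_add_right, real_inner_comm]

theorem continuous_edgeCos {n : ℕ} [NeZero n] :
    Continuous (edgeCos : State n → Fin n → ℝ) := by
  unfold edgeCos
  fun_prop

/-- The potential `∑ Γ_i · Γ_{i+1}`. -/
noncomputable def potential {n : ℕ} [NeZero n] (Γ : State n) : ℝ := ∑ i, edgeCos Γ i

theorem continuous_potential {n : ℕ} [NeZero n] : Continuous (potential : State n → ℝ) := by
  unfold potential
  have := continuous_edgeCos (n := n)
  fun_prop

/-! ### Distances -/

theorem cos_geoDist (x y : S2) : cos (geoDist x y) = inner ℝ (x : E3) (y : E3) := by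
  rw [geoDist, Real.cos_arccos]
  · have := neg_le_of_abs_le (abs_real_inner_le_norm (x : E3) (y : E3)); simpa using this
  · have := real_inner_le_norm (x : E3) (y : E3); simpa using this

/-- The chord is 2 sin(θ/2), and 2x/π ≤ sin x ≤ x on [0, π/2]. The two metrics are thus equivalent,
so topological arguments can use the chordal one. -/
theorem dist_le_geoDist (x y : S2) : dist x y ≤ geoDist x y ∧ geoDist x y ≤ π / 2 * dist x y := by
  set θ := geoDist x y with hθ
  have hc : inner ℝ (x : E3) (y : E3) = cos θ := (cos_geoDist x y).symm
  have h0 : 0 ≤ θ := Real.arccos_nonneg _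
  have h1 : θ ≤ π := Real.arccos_le_pi _
  have hs : 0 ≤ sin (θ / 2) := Real.sin_nonneg_of_nonneg_of_le_pi (by linarith) (by linarith)
  have hd : dist x y = 2 * sin (θ / 2) := by
    have h2 : dist x y ^ 2 = (2 * sin (θ / 2)) ^ 2 := by
      rw [Subtype.dist_eq, dist_eq_norm, norm_sub_sq_real, hc, norm_eq_of_mem_sphere,
        norm_eq_of_mem_sphere, mul_pow, Real.sin_sq_eq_half_sub, mul_div_cancel₀ _ two_ne_zero]
      ring
    exact (pow_left_inj₀ dist_nonneg (by positivity) two_ne_zero).1 h2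
  rw [hd]
  constructor
  · have := Real.sin_le (show 0 ≤ θ / 2 by linarith)
    linarith
  · have := Real.mul_le_sin (show 0 ≤ θ / 2 by linarith) (by linarith)
    have hp := Real.pi_pos
    have h3 : π / 2 * (2 / π * (θ / 2)) = θ / 2 := by field_simp
    nlinarith [mul_le_mul_of_nonneg_left this (show (0:ℝ) ≤ π / 2 by positivity)]

theorem geoDist_nonneg (x y : S2) : 0 ≤ geoDist x y := Real.arccos_nonneg _

theorem dist_le_stateDist {n : ℕ} (Γ Γ' : State n) : dist Γ Γ' ≤ stateDist Γ Γ' := by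
  have hb : BddAbove (range fun i => geoDist (Γ i) (Γ' i)) := (finite_range _).bddAbove
  refine (dist_pi_le_iff (Real.iSup_nonneg fun i => geoDist_nonneg _ _)).2 fun i => ?_
  exact (dist_le_geoDist _ _).1.trans (le_ciSup hb i)

theorem stateDist_le_dist {n : ℕ} (Γ Γ' : State n) : stateDist Γ Γ' ≤ π / 2 * dist Γ Γ' := by
  refine Real.iSup_le (fun i => ?_) (by positivity)
  refine (dist_le_geoDist _ _).2.trans ?_
  have := dist_le_pi_dist Γ Γ' i
  gcongr

theorem infDist_le_setDist {n : ℕ} {M : Set (State n)} (hM : M.Nonempty) (Γ : State n) :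
    Metric.infDist Γ M ≤ setDist M Γ := by
  have := hM.to_subtype
  exact le_ciInf fun Γ' => (Metric.infDist_le_dist_of_mem Γ'.2).trans (dist_le_stateDist _ _)

theorem setDist_le_infDist {n : ℕ} {M : Set (State n)} (hM : M.Nonempty) (Γ : State n) :
    setDist M Γ ≤ π / 2 * Metric.infDist Γ M := by
  have hp : (0 : ℝ) < π / 2 := by positivity
  rw [← div_le_iff₀' hp, Metric.le_infDist hM]
  intro Γ' hΓ'
  rw [div_le_iff₀' hp]
  have hb : BddBelow (range fun Γ' : M => stateDist Γ (Γ' : State n)) := by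
    refine ⟨0, ?_⟩
    rintro _ ⟨x, rfl⟩
    exact dist_nonneg.trans (dist_le_stateDist _ _)
  exact (ciInf_le hb ⟨Γ', hΓ'⟩).trans (stateDist_le_dist _ _)

theorem approaches_iff {n : ℕ} {M : Set (State n)} (hM : M.Nonempty) (Γ : ℝ → State n) :
    Approaches Γ M ↔ Tendsto (fun t => Metric.infDist (Γ t) M) atTop (𝓝 0) := by
  constructor
  · intro h
    exact squeeze_zero (fun _ => Metric.infDist_nonneg) (fun t => infDist_le_setDist hM _) h
  · intro h
    have h2 := h.const_mul (π / 2)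
    rw [mul_zero] at h2
    exact squeeze_zero (fun t => Metric.infDist_nonneg.trans (infDist_le_setDist hM _))
      (fun t => setDist_le_infDist hM _) h2

/-! ### Rotations -/

theorem mem_rotation_iff {R : Matrix (Fin 3) (Fin 3) ℝ} :
    R ∈ Matrix.specialOrthogonalGroup (Fin 3) ℝ ↔ R.transpose * R = 1 ∧ R.det = 1 := by
  rw [Matrix.mem_specialOrthogonalGroup_iff, Matrix.mem_orthogonalGroup_iff']

theorem transpose_mem_rotation {R : Matrix (Fin 3) (Fin 3) ℝ}
    (hR : R ∈ Matrix.specialOrthogonalGroup (Fin 3) ℝ) :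
    R.transpose ∈ Matrix.specialOrthogonalGroup (Fin 3) ℝ := by
  rw [mem_rotation_iff] at hR ⊢
  rw [Matrix.transpose_transpose, Matrix.det_transpose]
  exact ⟨mul_eq_one_comm.1 hR.1, hR.2⟩

theorem act_transpose_act {R : Matrix (Fin 3) (Fin 3) ℝ}
    (hR : R ∈ Matrix.specialOrthogonalGroup (Fin 3) ℝ) (x : E3) : act R.transpose (act R x) = x := by
  rw [← act_mul, (mem_rotation_iff.1 hR).1, act_one]

theorem inner_act_left (R : Matrix (Fin 3) (Fin 3) ℝ) (x y : E3) :
    inner ℝ (act R x) y = inner ℝ x (act R.transpose y) := by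
  simp only [inner_eq_coords, act_apply_coords, Matrix.transpose_apply]; ring

theorem inner_act_act {R : Matrix (Fin 3) (Fin 3) ℝ}
    (hR : R ∈ Matrix.specialOrthogonalGroup (Fin 3) ℝ) (x y : E3) :
    inner ℝ (act R x) (act R y) = inner ℝ x y := by
  rw [inner_act_left, act_transpose_act hR]

/-- The matrix with columns `u`, `v` and `u × v`. -/
noncomputable def frame (u v : E3) : Matrix (Fin 3) (Fin 3) ℝ :=
  !![u 0, v 0, cross u v 0; u 1, v 1, cross u v 1; u 2, v 2, cross u v 2]

theorem frame_mem_rotation {u v : E3} (hu : inner ℝ u u = 1) (hv : inner ℝ v v = 1)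
    (huv : inner ℝ u v = 0) : frame u v ∈ Matrix.specialOrthogonalGroup (Fin 3) ℝ := by
  have hw : inner ℝ (cross u v) (cross u v) = 1 := by
    rw [inner_cross_cross, hu, hv, huv]; simp
  have h1 := inner_cross_left u v
  have h2 := inner_cross_right u v
  rw [mem_rotation_iff]
  rw [inner_eq_coords] at hu hv huv hw h1 h2
  constructor
  · ext i j
    fin_cases i <;> fin_cases j <;>
      simp [frame, Matrix.mul_apply, Fin.sum_univ_three, -cross_apply_zero, -cross_apply_one,
        -cross_apply_two] <;> linarith
  · rw [← hw]
    simp [frame, Matrix.det_fin_three]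
    ring

theorem act_frame (u v y : E3) :
    act (frame u v) y = y 0 • u + y 1 • v + y 2 • cross u v := by
  apply ext_coords <;> simp [act_apply_coords, frame] <;> ring

theorem act_frame_transpose (u v y : E3) :
    act (frame u v).transpose y = !₂[inner ℝ u y, inner ℝ v y, inner ℝ (cross u v) y] := by
  apply ext_coords <;> simp [act_apply_coords, frame, inner_eq_coords]

theorem eq_of_inner_sub_self {x y : E3} (h : inner ℝ (x - y) (x - y) = 0) : x = y :=
  sub_eq_zero.1 (inner_self_eq_zero.1 h)

theorem exists_orthogonal_decomposition (p q : S2) :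
    ∃ v : S2, inner ℝ (p : E3) (v : E3) = 0 ∧
      (q : E3) = inner ℝ (p : E3) (q : E3) • (p : E3) +
        √(1 - inner ℝ (p : E3) (q : E3) ^ 2) • (v : E3) := by
  set c : ℝ := inner ℝ (p : E3) (q : E3) with hc
  have hpp := inner_self_sphere p
  have hqq := inner_self_sphere q
  have hd : inner ℝ ((q : E3) - c • (p : E3)) ((q : E3) - c • (p : E3)) = 1 - c ^ 2 := by
    simp only [inner_sub_left, inner_sub_right, inner_smul_left, inner_smul_right, hqq, hpp,
      real_inner_comm (p : E3) (q : E3), ← hc]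
    simp; ring
  have hnn : 0 ≤ 1 - c ^ 2 := by rw [← hd]; exact real_inner_self_nonneg
  have hs : √(1 - c ^ 2) ^ 2 = 1 - c ^ 2 := Real.sq_sqrt hnn
  by_cases h : √(1 - c ^ 2) = 0
  -- Here q = ±p and the direction v is arbitrary.
  · obtain ⟨v, hv⟩ := exists_orthogonal_unit p
    refine ⟨v, hv, ?_⟩
    rw [h, zero_smul, add_zero]
    apply eq_of_inner_sub_self
    rw [hd, ← hs, h]; norm_num
  · refine ⟨unitOf ((√(1 - c ^ 2))⁻¹ • ((q : E3) - c • (p : E3))) ?_, ?_, ?_⟩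
    · rw [inner_smul_left, inner_smul_right, hd, ← hs]
      simp; field_simp
    · simp only [unitOf, inner_smul_right, inner_sub_right, hpp, ← hc]
      ring
    · simp only [unitOf, smul_smul, mul_inv_cancel₀ h, one_smul]
      abel

/-- Complete each pair to an oriented orthonormal frame, and carry one frame to the other. The pair
has the same coordinates in both frames. -/
theorem exists_rotation_of_inner_eq {p q p' q' : S2}
    (h : inner ℝ (p : E3) (q : E3) = inner ℝ (p' : E3) (q' : E3)) :
    ∃ R ∈ Matrix.specialOrthogonalGroup (Fin 3) ℝ, act R p = p' ∧ act R q = q' := by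
  obtain ⟨v, hv, hq⟩ := exists_orthogonal_decomposition p q
  obtain ⟨v', hv', hq'⟩ := exists_orthogonal_decomposition p' q'
  have hF := frame_mem_rotation (inner_self_sphere p) (inner_self_sphere v) hv
  have hF' := frame_mem_rotation (inner_self_sphere p') (inner_self_sphere v') hv'
  have h1 : act (frame p' v' * (frame (p : E3) v).transpose) p = p' := by
    rw [act_mul, act_frame_transpose, act_frame, inner_self_sphere, real_inner_comm, hv,
      real_inner_comm, inner_cross_left]
    simp
  have h2 : act (frame p' v' * (frame (p : E3) v).transpose) v = v' := by
    rw [act_mul, act_frame_transpose, act_frame, inner_self_sphere, hv,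
      real_inner_comm (v : E3) (cross _ _), inner_cross_right]
    simp
  refine ⟨_, mul_mem hF' (transpose_mem_rotation hF), h1, ?_⟩
  rw [hq, act_add, act_smul, act_smul, h1, h2, hq', h]

/-! ### Euler angles and the connectedness of SO(3). -/

theorem exists_cos_sin_of_sq_add_sq {a b : ℝ} (h : a ^ 2 + b ^ 2 = 1) :
    ∃ θ : ℝ, a = cos θ ∧ b = sin θ := by
  have hn : ‖(⟨a, b⟩ : ℂ)‖ = 1 := by
    have h2 : ‖(⟨a, b⟩ : ℂ)‖ ^ 2 = 1 := by
      rw [Complex.sq_norm, Complex.normSq_apply]; simpa [sq] using h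
    exact (pow_eq_one_iff_of_nonneg (norm_nonneg _) two_ne_zero).1 h2
  refine ⟨Complex.arg ⟨a, b⟩, ?_, ?_⟩
  · rw [Complex.cos_arg (by intro h0; rw [h0] at hn; simp at hn), hn]; simp
  · rw [Complex.sin_arg, hn]; simp

/-- The rotation about the third axis. -/
noncomputable def rotZ (θ : ℝ) : Matrix (Fin 3) (Fin 3) ℝ :=
  !![cos θ, -sin θ, 0; sin θ, cos θ, 0; 0, 0, 1]

/-- The rotation about the second axis. -/
noncomputable def rotY (θ : ℝ) : Matrix (Fin 3) (Fin 3) ℝ :=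
  !![cos θ, 0, sin θ; 0, 1, 0; -sin θ, 0, cos θ]

theorem rotZ_mem_rotation (θ : ℝ) : rotZ θ ∈ Matrix.specialOrthogonalGroup (Fin 3) ℝ := by
  have h := Real.sin_sq_add_cos_sq θ
  rw [mem_rotation_iff]
  constructor
  · ext i j
    fin_cases i <;> fin_cases j <;> simp [rotZ, Matrix.mul_apply, Fin.sum_univ_three] <;> linarith
  · simp [rotZ, Matrix.det_fin_three]; linarith

theorem rotY_mem_rotation (θ : ℝ) : rotY θ ∈ Matrix.specialOrthogonalGroup (Fin 3) ℝ := by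
  have h := Real.sin_sq_add_cos_sq θ
  rw [mem_rotation_iff]
  constructor
  · ext i j
    fin_cases i <;> fin_cases j <;> simp [rotY, Matrix.mul_apply, Fin.sum_univ_three] <;> linarith
  · simp [rotY, Matrix.det_fin_three]; linarith

theorem exists_rotZ_of_fix {Q : Matrix (Fin 3) (Fin 3) ℝ}
    (hQ : Q ∈ Matrix.specialOrthogonalGroup (Fin 3) ℝ) (h0 : Q 0 2 = 0) (h1 : Q 1 2 = 0)
    (h2 : Q 2 2 = 1) : ∃ c, Q = rotZ c := by
  obtain ⟨ho, hd⟩ := mem_rotation_iff.1 hQ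
  have e : ∀ i j, Q 0 i * Q 0 j + Q 1 i * Q 1 j + Q 2 i * Q 2 j =
      (1 : Matrix (Fin 3) (Fin 3) ℝ) i j := by
    intro i j
    rw [← ho, Matrix.mul_apply, Fin.sum_univ_three]; rfl
  have e02 := e 0 2
  have e12 := e 1 2
  have e00 := e 0 0
  have e01 := e 0 1
  simp [h0, h1, h2] at e02 e12
  simp [e02, e12] at e00 e01
  rw [Matrix.det_fin_three] at hd
  simp [h0, h1, h2, e02, e12] at hd
  obtain ⟨c, hc, hs⟩ := exists_cos_sin_of_sq_add_sq (a := Q 0 0) (b := Q 1 0) (by linarith)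
  have k1 : Q 1 1 = cos c := by
    rw [← hc]; linear_combination Q 0 0 * hd + Q 1 0 * e01 - Q 1 1 * e00
  have k2 : Q 0 1 = -sin c := by
    rw [← hs]; linear_combination Q 0 0 * e01 - Q 0 1 * e00 - Q 1 0 * hd
  refine ⟨c, ?_⟩
  ext i j
  fin_cases i <;> fin_cases j <;> simp [rotZ, h0, h1, h2, e02, e12, k1, k2, hc, hs]

/-- Spherical coordinates (a, b) of the third column give a product of two axis rotations with that
same column; what remains after undoing it fixes the third axis, hence is a rotation about it. -/
theorem exists_euler_angles {R : Matrix (Fin 3) (Fin 3) ℝ}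
    (hR : R ∈ Matrix.specialOrthogonalGroup (Fin 3) ℝ) :
    ∃ a b c : ℝ, R = rotZ a * rotY b * rotZ c := by
  have ho := mul_eq_one_comm.1 (mem_rotation_iff.1 (transpose_mem_rotation hR)).1
  rw [Matrix.transpose_transpose] at ho
  have hcol : R 0 2 ^ 2 + R 1 2 ^ 2 + R 2 2 ^ 2 = 1 := by
    have := congrFun (congrFun ho 2) 2
    rw [Matrix.mul_apply, Fin.sum_univ_three] at this
    simp at this
    linarith
  obtain ⟨a, b, h0, h1, h2⟩ : ∃ a b, R 0 2 = cos a * sin b ∧ R 1 2 = sin a * sin b ∧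
      R 2 2 = cos b := by
    set r := √(R 0 2 ^ 2 + R 1 2 ^ 2) with hr
    have hr2 : r ^ 2 = R 0 2 ^ 2 + R 1 2 ^ 2 := Real.sq_sqrt (by positivity)
    obtain ⟨b, hb, hb'⟩ := exists_cos_sin_of_sq_add_sq (a := R 2 2) (b := r) (by linarith)
    by_cases h : r = 0
    · rw [h] at hr2 hb'
      refine ⟨0, b, ?_, ?_, hb⟩ <;> rw [← hb'] <;> simp <;>
        nlinarith [sq_nonneg (R 0 2), sq_nonneg (R 1 2)]
    · obtain ⟨a, ha, ha'⟩ := exists_cos_sin_of_sq_add_sq (a := R 0 2 / r) (b := R 1 2 / r)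
        (by field_simp; linarith)
      refine ⟨a, b, ?_, ?_, hb⟩
      · rw [← ha, ← hb']; field_simp
      · rw [← ha', ← hb']; field_simp
  have hS := mul_mem (rotZ_mem_rotation a) (rotY_mem_rotation b)
  have sa := Real.sin_sq_add_cos_sq a
  have sb := Real.sin_sq_add_cos_sq b
  obtain ⟨c, hc⟩ := exists_rotZ_of_fix (mul_mem (transpose_mem_rotation hS) hR)
    (by simp [rotZ, rotY, Matrix.mul_apply, Fin.sum_univ_three, h0, h1, h2]
        linear_combination sin b * cos b * sa)
    (by simp [rotZ, rotY, Matrix.mul_apply, Fin.sum_univ_three, h0, h1, h2]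
        ring)
    (by simp [rotZ, rotY, Matrix.mul_apply, Fin.sum_univ_three, h0, h1, h2]
        linear_combination sin b ^ 2 * sa + sb)
  refine ⟨a, b, c, ?_⟩
  rw [← hc, ← mul_assoc, mul_eq_one_comm.1 (mem_rotation_iff.1 hS).1, one_mul]

theorem continuous_rotZ : Continuous rotZ := by
  refine continuous_matrix fun i j => ?_
  fin_cases i <;> fin_cases j <;> simp [rotZ] <;> fun_prop

theorem continuous_rotY : Continuous rotY := by
  refine continuous_matrix fun i j => ?_
  fin_cases i <;> fin_cases j <;> simp [rotY] <;> fun_prop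

/-- Euler angles present SO(3) as a continuous image of ℝ³. -/
theorem isPreconnected_rotations :
    IsPreconnected (Matrix.specialOrthogonalGroup (Fin 3) ℝ : Set (Matrix (Fin 3) (Fin 3) ℝ)) := by
  have : (Matrix.specialOrthogonalGroup (Fin 3) ℝ : Set (Matrix (Fin 3) (Fin 3) ℝ)) =
      range fun p : ℝ × ℝ × ℝ => rotZ p.1 * rotY p.2.1 * rotZ p.2.2 := by
    ext R
    constructor
    · intro hR
      obtain ⟨a, b, c, h⟩ := exists_euler_angles hR
      exact ⟨(a, b, c), h.symm⟩
    · rintro ⟨p, rfl⟩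
      exact mul_mem (mul_mem (rotZ_mem_rotation _) (rotY_mem_rotation _)) (rotZ_mem_rotation _)
  rw [this]
  have hZ := continuous_rotZ
  have hY := continuous_rotY
  exact isPreconnected_range (by fun_prop)

/-- The rotated state. -/
def rotate {n : ℕ} {R : Matrix (Fin 3) (Fin 3) ℝ}
    (hR : R ∈ Matrix.specialOrthogonalGroup (Fin 3) ℝ) (Γ : State n) : State n :=
  fun i => unitOf (act R (Γ i)) (by rw [inner_act_act hR, inner_self_sphere])

theorem rotate_mem_rotationOrbit {n : ℕ} {R : Matrix (Fin 3) (Fin 3) ℝ}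
    (hR : R ∈ Matrix.specialOrthogonalGroup (Fin 3) ℝ) (Γ : State n) :
    rotate hR Γ ∈ rotationOrbit Γ := ⟨R, hR, fun _ => rfl⟩

theorem self_mem_rotationOrbit {n : ℕ} (Γ : State n) : Γ ∈ rotationOrbit Γ :=
  ⟨1, one_mem _, fun _ => (act_one _).symm⟩

theorem isPreconnected_rotationOrbit {n : ℕ} (Γ : State n) : IsPreconnected (rotationOrbit Γ) := by
  have hc : IsPreconnected (univ : Set (Matrix.specialOrthogonalGroup (Fin 3) ℝ)) :=
    preconnectedSpace_iff_univ.1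
      (isPreconnected_iff_preconnectedSpace.1 isPreconnected_rotations)
  have : rotationOrbit Γ =
      (fun R : Matrix.specialOrthogonalGroup (Fin 3) ℝ => rotate R.2 Γ) '' univ := by
    ext Γ'
    constructor
    · rintro ⟨R, hR, h⟩
      exact ⟨⟨R, hR⟩, mem_univ _, funext fun j => Subtype.ext (h j).symm⟩
    · rintro ⟨R, -, rfl⟩
      exact rotate_mem_rotationOrbit R.2 Γ
  rw [this]
  refine hc.image _ (Continuous.continuousOn ?_)
  refine continuous_pi fun _ => Continuous.subtype_mk ?_ _
  exact continuous_act.comp (continuous_subtype_val.prodMk continuous_const)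

theorem edgeCos_eq_of_mem_rotationOrbit {n : ℕ} [NeZero n] {Γ Γ' : State n}
    (h : Γ' ∈ rotationOrbit Γ) : edgeCos Γ' = edgeCos Γ := by
  obtain ⟨R, hR, h⟩ := h
  funext i
  rw [edgeCos, h, h, inner_act_act hR]; rfl

/-! ### Equilibria -/

theorem exists_rotatesToEquator {n : ℕ} {Γ : State n} {u : S2}
    (hu : ∀ i, inner ℝ (u : E3) (Γ i : E3) = 0) :
    ∃ (R : Matrix (Fin 3) (Fin 3) ℝ) (ψ : Fin n → ℝ), RotatesToEquator R Γ ψ := by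
  obtain ⟨v, hv⟩ := exists_orthogonal_unit u
  have hF := frame_mem_rotation (u := v) (v := cross u v) (inner_self_sphere v)
    (by rw [inner_cross_cross, inner_self_sphere, inner_self_sphere, hv]; simp)
    (inner_cross_right _ _)
  have hR := transpose_mem_rotation hF
  have hw : cross (v : E3) (cross u v) = u := by
    rw [cross_cross, inner_self_sphere, real_inner_comm, hv]; simp
  have key : ∀ i, ∃ θ : ℝ, act (frame (v : E3) (cross u v)).transpose (Γ i) =
      sphericalPoint θ 0 := by
    intro i
    have h2 := coords_sphere (rotate hR Γ i)
    have h3 : (rotate hR Γ i : E3) = act (frame (v : E3) (cross u v)).transpose (Γ i) := rfl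
    have h4 : (rotate hR Γ i : E3) 2 = 0 := by
      rw [h3, act_frame_transpose, hw]; simpa using hu i
    rw [h4] at h2
    obtain ⟨θ, hθ, hθ'⟩ := exists_cos_sin_of_sq_add_sq (a := (rotate hR Γ i : E3) 0)
      (b := (rotate hR Γ i : E3) 1) (by linarith)
    refine ⟨θ, ?_⟩
    rw [← h3]
    apply ext_coords
    · simp [sphericalPoint, hθ]
    · simp [sphericalPoint, hθ']
    · simp [sphericalPoint, h4]
  choose ψ hψ using key
  exact ⟨_, ψ, hR, hψ⟩

theorem inner_of_rotatesToEquator {n : ℕ} {R : Matrix (Fin 3) (Fin 3) ℝ} {Γ : State n} {ψ : Fin n → ℝ}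
    (h : RotatesToEquator R Γ ψ) (i j : Fin n) :
    inner ℝ (Γ i : E3) (Γ j : E3) = cos (ψ i - ψ j) := by
  rw [← inner_act_act h.1, h.2, h.2, inner_eq_coords, Real.cos_sub]
  simp [sphericalPoint]

section Equilibria

variable {n : ℕ} [NeZero n]

theorem mem_equilibriumSet_iff (hn : 3 ≤ n) {Γ : State n} :
    Γ ∈ equilibriumSet (undirectedRing n) ↔
      ∀ i, neighbourSum Γ i = (edgeCos Γ (i - 1) + edgeCos Γ i) • (Γ i : E3) := by
  simp only [equilibriumSet, mem_ofPred_eq, velocity_eq hn, inner_neighbourSum, sub_eq_zero]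
  exact forall_congr' fun i => eq_comm

theorem mem_equilibriumSet_of_smul (hn : 3 ≤ n) {Γ : State n} {c : Fin n → ℝ}
    (h : ∀ i, neighbourSum Γ i = c i • (Γ i : E3)) : Γ ∈ equilibriumSet (undirectedRing n) := by
  intro i
  rw [velocity_eq hn, h i, inner_smul_right, inner_self_sphere, mul_one, sub_self]

theorem continuous_neighbourSum (i : Fin n) :
    Continuous fun Γ : State n => neighbourSum Γ i := by
  unfold neighbourSum
  fun_prop

theorem continuous_velocity (hn : 3 ≤ n) (i : Fin n) :
    Continuous fun Γ : State n => velocity (undirectedRing n) Γ i := by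
  simp only [velocity_eq hn]
  have := continuous_neighbourSum (n := n) i
  fun_prop

theorem isCompact_equilibriumSet (hn : 3 ≤ n) :
    IsCompact (equilibriumSet (undirectedRing n)) := by
  refine IsClosed.isCompact ?_
  simp only [equilibriumSet, ofPred_forall]
  exact isClosed_iInter fun i => isClosed_eq (continuous_velocity hn i) continuous_const

/-- Crossing the equilibrium equation at i + 1 with Γ_{i+1} kills its right-hand side and leaves the
equality of two consecutive cross products. -/
theorem cross_const (hn : 3 ≤ n) {Γ : State n} (h : Γ ∈ equilibriumSet (undirectedRing n))
    (i : Fin n) : cross (Γ i) (Γ (i + 1)) = cross (Γ 0) (Γ 1) := by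
  induction i using cyclic_induction with
  | h0 => rw [zero_add]
  | hs i ih =>
    rw [← ih]
    have h1 := (mem_equilibriumSet_iff hn).1 h (i + 1)
    rw [neighbourSum, add_sub_cancel_right] at h1
    have h2 := congrArg (cross (Γ (i + 1) : E3)) h1
    rw [cross_add_right, cross_smul_right, cross_self, smul_zero] at h2
    rw [cross_swap (Γ i : E3), eq_neg_iff_add_eq_zero, add_comm]
    exact h2

theorem edgeCos_sq_eq (Γ : State n) (i : Fin n) : edgeCos Γ i ^ 2 =
    1 - inner ℝ (cross (Γ i) (Γ (i + 1))) (cross (Γ i) (Γ (i + 1))) := by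
  rw [inner_cross_cross, inner_self_sphere, inner_self_sphere, real_inner_comm, edgeCos]
  rw [real_inner_comm]; ring

theorem edgeCos_sq_const (hn : 3 ≤ n) {Γ : State n} (h : Γ ∈ equilibriumSet (undirectedRing n))
    (i j : Fin n) : edgeCos Γ i ^ 2 = edgeCos Γ j ^ 2 := by
  rw [edgeCos_sq_eq, edgeCos_sq_eq, cross_const hn h, cross_const hn h]

theorem exists_normal (hn : 3 ≤ n) {Γ : State n} (h : Γ ∈ equilibriumSet (undirectedRing n)) :
    ∃ u : S2, ∀ i, inner ℝ (u : E3) (Γ i : E3) = 0 := by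
  by_cases h0 : cross (Γ 0) (Γ 1) = 0
  -- Degenerate case: consecutive agents are parallel, so every direction orthogonal to the first
  -- agent is orthogonal to all.
  · obtain ⟨u, hu⟩ := exists_orthogonal_unit (Γ 0)
    refine ⟨u, fun i => ?_⟩
    induction i using cyclic_induction with
    | h0 => rw [real_inner_comm]; exact hu
    | hs i ih =>
      have h1 := cross_cross (Γ i : E3) (Γ i) (Γ (i + 1))
      rw [cross_const hn h, h0, inner_self_sphere, one_smul, show cross (Γ i : E3) 0 = 0 by
        simpa using cross_smul_right (Γ i : E3) 0 0] at h1
      rw [← sub_eq_zero.1 h1.symm, inner_smul_right, ih, mul_zero]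
  · have hN : ‖cross (Γ 0 : E3) (Γ 1)‖ ≠ 0 := norm_ne_zero_iff.2 h0
    have hunit : inner ℝ ((‖cross (Γ 0 : E3) (Γ 1)‖)⁻¹ • cross (Γ 0 : E3) (Γ 1))
        ((‖cross (Γ 0 : E3) (Γ 1)‖)⁻¹ • cross (Γ 0 : E3) (Γ 1)) = 1 := by
      rw [inner_smul_left, inner_smul_right, real_inner_self_eq_norm_sq]
      simp; field_simp
    refine ⟨unitOf _ hunit, fun i => ?_⟩
    simp only [unitOf]
    rw [inner_smul_left, ← cross_const hn h i, real_inner_comm, inner_cross_left, mul_zero]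

theorem mem_equilibriumSet_of_mem_rotationOrbit (hn : 3 ≤ n) {Γ Γ' : State n}
    (h : Γ ∈ equilibriumSet (undirectedRing n)) (h' : Γ' ∈ rotationOrbit Γ) :
    Γ' ∈ equilibriumSet (undirectedRing n) := by
  rw [mem_equilibriumSet_iff hn] at h ⊢
  rw [edgeCos_eq_of_mem_rotationOrbit h']
  obtain ⟨R, hR, h'⟩ := h'
  intro i
  rw [neighbourSum, h', h', h', ← act_add, ← act_smul, ← h i]; rfl

theorem sin_sub_const (hn : 3 ≤ n) {Γ : State n} (hΓ : Γ ∈ equilibriumSet (undirectedRing n))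
    {R : Matrix (Fin 3) (Fin 3) ℝ} {ψ : Fin n → ℝ} (h : RotatesToEquator R Γ ψ) (i j : Fin n) :
    sin (ψ (i + 1) - ψ i) = sin (ψ (j + 1) - ψ j) := by
  have key : ∀ i, sin (ψ (i + 1) - ψ i) =
      cross (rotate h.1 Γ i : E3) (rotate h.1 Γ (i + 1) : E3) 2 := by
    intro i
    change _ = cross (act R (Γ i)) (act R (Γ (i + 1))) 2
    rw [h.2, h.2, Real.sin_sub]
    simp [sphericalPoint]
    ring
  have hr := mem_equilibriumSet_of_mem_rotationOrbit hn hΓ (rotate_mem_rotationOrbit h.1 Γ)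
  rw [key, key, cross_const hn hr, cross_const hn hr]

/-! ### Finiteness of the formation types -/

/-- Equal sines mean δ_i = ±θ modulo π. The sign is written 1 + 2b so that a sum of n signs is
visibly odd for odd n, hence nonzero; this is where oddness makes the equilibria rigid. -/
theorem exists_sum_of_sin_eq {n : ℕ} (hodd : Odd n) {δ : Fin n → ℝ} {θ : ℝ}
    (h : ∀ i, sin (δ i) = sin θ) :
    ∃ k a : ℤ, k ≠ 0 ∧ |k| ≤ n ∧ ∑ i, δ i = k * θ + a * π := by
  have key : ∀ i, ∃ b a : ℤ, |1 + 2 * b| = 1 ∧ δ i = (1 + 2 * b) * θ + a * π := by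
    intro i
    obtain ⟨m, hm | hm⟩ := Real.sin_eq_sin_iff.1 (h i)
    · exact ⟨0, -2 * m, by simp, by push_cast; linarith⟩
    · exact ⟨-1, 2 * m + 1, by simp, by push_cast; linarith⟩
  choose b a hb ha using key
  refine ⟨∑ i, (1 + 2 * b i), ∑ i, a i, ?_, ?_, ?_⟩
  · obtain ⟨m, rfl⟩ := hodd
    rw [Finset.sum_add_distrib, ← Finset.mul_sum]
    simp only [Finset.sum_const, Finset.card_univ, Fintype.card_fin, nsmul_eq_mul, mul_one]
    push_cast
    omega
  · refine (Finset.abs_sum_le_sum_abs _ _).trans ?_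
    simp [hb]
  · push_cast
    rw [Finset.sum_mul, Finset.sum_mul, ← Finset.sum_add_distrib]
    exact Finset.sum_congr rfl fun i _ => ha i

/-- Such a cosine is the real part of a (2K)-th root of unity. -/
theorem finite_cos_rational (K : ℕ) (hK : K ≠ 0) :
    {x : ℝ | ∃ (θ : ℝ) (a : ℤ), K * θ = a * π ∧ x = cos θ}.Finite := by
  have hfin : (Complex.re '' {z : ℂ | z ^ (2 * K) = 1}).Finite := by
    refine Set.Finite.image _ ?_
    have : {z : ℂ | z ^ (2 * K) = 1} ⊆ (Polynomial.nthRootsFinset (2 * K) (1 : ℂ) : Set ℂ) := by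
      intro z hz
      simpa [Polynomial.mem_nthRootsFinset (show 0 < 2 * K by omega)] using hz
    exact (Finset.finite_toSet _).subset this
  refine hfin.subset ?_
  rintro x ⟨θ, a, h, rfl⟩
  refine ⟨Complex.exp (θ * Complex.I), ?_, Complex.exp_ofReal_mul_I_re θ⟩
  rw [mem_ofPred_eq, ← Complex.exp_nat_mul, Complex.exp_eq_one_iff]
  refine ⟨a, ?_⟩
  have h' : (K : ℂ) * θ = a * π := by exact_mod_cast congrArg (fun x : ℝ => (x : ℂ)) h
  push_cast
  linear_combination 2 * Complex.I * h'

theorem finite_edgeCos_image (hn : 3 ≤ n) (hodd : Odd n) :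
    (edgeCos '' equilibriumSet (undirectedRing n)).Finite := by
  refine (Set.Finite.pi' fun _ : Fin n =>
    finite_cos_rational n.factorial (Nat.factorial_ne_zero n)).subset ?_
  rintro _ ⟨Γ, hΓ, rfl⟩ i
  obtain ⟨u, hu⟩ := exists_normal hn hΓ
  obtain ⟨R, ψ, h⟩ := exists_rotatesToEquator hu
  obtain ⟨k, a, hk0, hk, hsum⟩ := exists_sum_of_sin_eq hodd fun j => sin_sub_const hn hΓ h j i
  rw [Finset.sum_sub_distrib, sum_add_one ψ, sub_self] at hsum
  -- The increments around the ring sum to zero, so kθ is a multiple of π; n! serves as a common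
  -- denominator for all k with 0 < |k| ≤ n.
  obtain ⟨m, hm⟩ : k ∣ (n.factorial : ℤ) := by
    rw [← Int.natAbs_dvd, Int.natCast_dvd_natCast]
    have : (k.natAbs : ℤ) ≤ n := by rwa [Int.natCast_natAbs]
    exact Nat.dvd_factorial (Int.natAbs_pos.2 hk0) (by exact_mod_cast this)
  refine ⟨ψ (i + 1) - ψ i, -(m * a), ?_, ?_⟩
  · have : (n.factorial : ℝ) = k * m := by exact_mod_cast congrArg (fun x : ℤ => (x : ℝ)) hm
    rw [this]
    push_cast
    linear_combination -(m : ℝ) * hsum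
  · rw [edgeCos, inner_of_rotatesToEquator h, ← Real.cos_neg, neg_sub]

/-! ### Equilibrium manifolds are orbits -/

/-- The equilibrium equation expresses Γ_{i+2} through Γ_i, Γ_{i+1} and the edge cosines. A rotation
matching the first two agents therefore matches all of them. -/
theorem mem_rotationOrbit_of_edgeCos_eq (hn : 3 ≤ n) {Γ Γ' : State n}
    (h : Γ ∈ equilibriumSet (undirectedRing n)) (h' : Γ' ∈ equilibriumSet (undirectedRing n))
    (he : edgeCos Γ' = edgeCos Γ) : Γ' ∈ rotationOrbit Γ := by
  rw [mem_equilibriumSet_iff hn] at h h'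
  obtain ⟨R, hR, h0, h1⟩ := exists_rotation_of_inner_eq (p := Γ 0) (q := Γ (0 + 1)) (p' := Γ' 0)
    (q' := Γ' (0 + 1)) (congrFun he 0).symm
  refine ⟨R, hR, ?_⟩
  suffices H : ∀ i, (Γ' i : E3) = act R (Γ i) ∧ (Γ' (i + 1) : E3) = act R (Γ (i + 1)) from
    fun i => (H i).1
  intro i
  induction i using cyclic_induction with
  | h0 => exact ⟨h0.symm, h1.symm⟩
  | hs i ih =>
    refine ⟨ih.2, ?_⟩
    have e := h (i + 1)
    have e' := h' (i + 1)
    rw [neighbourSum, add_sub_cancel_right] at e e'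
    rw [eq_sub_of_add_eq' e', eq_sub_of_add_eq' e, act_sub, act_smul, ih.1, ih.2, he]

theorem rotationOrbit_eq_fibre (hn : 3 ≤ n) {Γ : State n}
    (h : Γ ∈ equilibriumSet (undirectedRing n)) :
    rotationOrbit Γ = equilibriumSet (undirectedRing n) ∩ edgeCos ⁻¹' {edgeCos Γ} := by
  ext Γ'
  exact ⟨fun h' => ⟨mem_equilibriumSet_of_mem_rotationOrbit hn h h',
    edgeCos_eq_of_mem_rotationOrbit h'⟩,
    fun h' => mem_rotationOrbit_of_edgeCos_eq hn h h'.1 h'.2⟩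

/-- On a connected set of equilibria the edge cosines take finitely many values, hence a single one,
so the component lies in one orbit; conversely orbits are connected. -/
theorem connectedComponentIn_eq_rotationOrbit (hn : 3 ≤ n) (hodd : Odd n) {Γ : State n}
    (h : Γ ∈ equilibriumSet (undirectedRing n)) :
    connectedComponentIn (equilibriumSet (undirectedRing n)) Γ = rotationOrbit Γ := by
  apply Subset.antisymm
  · rw [rotationOrbit_eq_fibre hn h]
    refine subset_inter (connectedComponentIn_subset _ _) fun Γ' h' => ?_
    have hpre := (isPreconnected_connectedComponentIn
      (F := equilibriumSet (undirectedRing n)) (x := Γ)).image edgeCos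
      continuous_edgeCos.continuousOn
    have hsub : (edgeCos '' connectedComponentIn (equilibriumSet (undirectedRing n)) Γ).Subsingleton :=
      not_nontrivial_iff.1 fun hnt => hpre.infinite_of_nontrivial hnt
        ((finite_edgeCos_image hn hodd).subset (image_mono (connectedComponentIn_subset _ _)))
    exact hsub (mem_image_of_mem _ h') (mem_image_of_mem _ (mem_connectedComponentIn h))
  · exact (isPreconnected_rotationOrbit Γ).subset_connectedComponentIn (self_mem_rotationOrbit Γ)
      fun Γ' h' => mem_equilibriumSet_of_mem_rotationOrbit hn h h'

theorem IsEquilibriumManifold.eq_rotationOrbit (hn : 3 ≤ n) (hodd : Odd n) {M : Set (State n)}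
    (hM : IsEquilibriumManifold (undirectedRing n) M) {Γ : State n} (h : Γ ∈ M) :
    M = rotationOrbit Γ := by
  obtain ⟨Γ₀, h₀, rfl⟩ := hM
  rw [connectedComponentIn_eq h, connectedComponentIn_eq_rotationOrbit hn hodd]
  exact connectedComponentIn_subset _ _ h

theorem isEquilibriumManifold_rotationOrbit (hn : 3 ≤ n) (hodd : Odd n) {Γ : State n}
    (h : Γ ∈ equilibriumSet (undirectedRing n)) :
    IsEquilibriumManifold (undirectedRing n) (rotationOrbit Γ) :=
  ⟨Γ, h, (connectedComponentIn_eq_rotationOrbit hn hodd h).symm⟩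

end Equilibria

/-! ### The spectrum of symmetric circulant matrices of the ring -/

section Spectrum

variable {n : ℕ} [NeZero n]

/-- The circulant matrix with `a` on the diagonal and `b` at neighbouring pairs of the ring. -/
def ringMatrix {R : Type*} [AddMonoid R] (a b : R) : Matrix (Fin n) (Fin n) R :=
  Matrix.of fun i j => (if j = i then a else 0) + (if j = i - 1 then b else 0) +
    (if j = i + 1 then b else 0)

theorem ringMatrix_mulVec {R : Type*} [CommRing R] (a b : R) (x : Fin n → R) (i : Fin n) :
    (ringMatrix a b).mulVec x i = a * x i + b * (x (i - 1) + x (i + 1)) := by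
  simp [ringMatrix, Matrix.mulVec, dotProduct, add_mul, Finset.sum_add_distrib]
  ring

theorem pow_val_add_one {w : ℂ} (hw : w ^ n = 1) (i : Fin n) :
    w ^ ((i + 1 : Fin n) : ℕ) = w ^ (i : ℕ) * w := by
  rw [Fin.val_add, Fin.val_one', Nat.add_mod_mod, ← pow_succ]
  conv_rhs => rw [← Nat.mod_add_div ((i : ℕ) + 1) n, pow_add, pow_mul, hw, one_pow, mul_one]

theorem pow_val_sub_one {w : ℂ} (hw : w ^ n = 1) (i : Fin n) :
    w ^ ((i - 1 : Fin n) : ℕ) = w ^ (i : ℕ) * w⁻¹ := by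
  have hw0 : w ≠ 0 := by
    rintro rfl
    rw [zero_pow (NeZero.ne n)] at hw
    exact zero_ne_one hw
  have := pow_val_add_one hw (i - 1)
  rw [sub_add_cancel] at this
  rw [this, mul_inv_cancel_right₀ hw0]

theorem ringMatrix_mulVec_character (a b : ℂ) {w : ℂ} (hw : w ^ n = 1) :
    (ringMatrix a b).mulVec (fun j : Fin n => w ^ (j : ℕ)) =
      (a + b * (w + w⁻¹)) • fun j : Fin n => w ^ (j : ℕ) := by
  funext i
  rw [ringMatrix_mulVec, pow_val_add_one hw, pow_val_sub_one hw]
  simp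
  ring

/-- The characters j ↦ ζ^(lj) of the cyclic group are eigenvectors. They form a Vandermonde matrix,
invertible because the powers of ζ are distinct, so the matrix is diagonalized over ℂ. -/
theorem charpoly_ringMatrix (a b : ℝ) :
    (ringMatrix a b : Matrix (Fin n) (Fin n) ℝ).charpoly =
      ∏ l : Fin n, (X - C (a + 2 * b * cos (((l : ℕ) : ℝ) * (2 * π / n)))) := by
  have hn0 : n ≠ 0 := NeZero.ne n
  apply Polynomial.map_injective (algebraMap ℝ ℂ) (algebraMap ℝ ℂ).injective
  rw [← Matrix.charpoly_map, Polynomial.map_prod]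
  set ζ : ℂ := Complex.exp (2 * π * Complex.I / n) with hζ
  have hprim : IsPrimitiveRoot ζ n := Complex.isPrimitiveRoot_exp n hn0
  set V : Matrix (Fin n) (Fin n) ℂ := Matrix.vandermonde fun i => ζ ^ (i : ℕ) with hV
  have hdet : V.det ≠ 0 := by
    rw [hV, Matrix.det_vandermonde_ne_zero_iff]
    intro i j hij
    exact Fin.ext (hprim.pow_inj i.2 j.2 hij)
  set d : Fin n → ℂ := fun l => ((a + 2 * b * cos (((l : ℕ) : ℝ) * (2 * π / n)) : ℝ) : ℂ) with hd
  have hM : ((ringMatrix a b : Matrix (Fin n) (Fin n) ℝ).map (algebraMap ℝ ℂ)) =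
      ringMatrix (a : ℂ) (b : ℂ) := by
    ext i j
    simp only [ringMatrix, Matrix.map_apply, Matrix.of_apply, Complex.coe_algebraMap,
      Complex.ofReal_add]
    split_ifs <;> simp
  have hMV : ringMatrix (a : ℂ) (b : ℂ) * V = V * Matrix.diagonal d := by
    ext i l
    have hw : (ζ ^ (l : ℕ)) ^ n = 1 := by
      rw [← pow_mul, mul_comm, pow_mul, hprim.pow_eq_one, one_pow]
    have hcol : ∀ j, V j l = (ζ ^ (l : ℕ)) ^ (j : ℕ) := fun j => by
      rw [hV, Matrix.vandermonde_apply, ← pow_mul, ← pow_mul, mul_comm]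
    have hsum : ζ ^ (l : ℕ) + (ζ ^ (l : ℕ))⁻¹ =
        2 * Complex.cos (((l : ℕ) : ℂ) * (2 * π / n)) := by
      rw [hζ, ← Complex.exp_nat_mul, ← Complex.exp_neg, Complex.two_cos]
      congr 2 <;> ring
    have := congrFun (ringMatrix_mulVec_character (a : ℂ) b hw) i
    rw [Matrix.mul_diagonal, Matrix.mul_apply]
    simp only [hcol]
    rw [show ∑ j, ringMatrix (a : ℂ) b i j * (ζ ^ (l : ℕ)) ^ (j : ℕ) =
      (ringMatrix (a : ℂ) b).mulVec (fun j : Fin n => (ζ ^ (l : ℕ)) ^ (j : ℕ)) i from rfl, this,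
      hsum, hd]
    simp
    ring
  have hu : IsUnit V := (Matrix.isUnit_iff_isUnit_det V).2 (isUnit_iff_ne_zero.2 hdet)
  obtain ⟨U, hU⟩ := hu
  rw [← hU] at hMV
  have hconj : ringMatrix (a : ℂ) (b : ℂ) = U.val * Matrix.diagonal d * U⁻¹.val := by
    rw [← hMV, mul_assoc, Units.mul_inv, mul_one]
  rw [hM, hconj, Matrix.coe_units_inv, Matrix.charpoly_units_conj, Matrix.charpoly_diagonal]
  refine Finset.prod_congr rfl fun l _ => ?_
  rw [Polynomial.map_sub, Polynomial.map_X, Polynomial.map_C]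
  rfl

theorem isHermitian_ringMatrix (a b : ℝ) :
    (ringMatrix a b : Matrix (Fin n) (Fin n) ℝ).IsHermitian := by
  ext i j
  have h1 : (i = j) ↔ (j = i) := eq_comm
  have h2 : (i = j - 1) ↔ (j = i + 1) := by rw [eq_sub_iff_add_eq, eq_comm]
  have h3 : (i = j + 1) ↔ (j = i - 1) := by rw [eq_sub_iff_add_eq, eq_comm]
  simp only [ringMatrix, Matrix.conjTranspose_apply, Matrix.of_apply, star_trivial, h1, h2, h3]
  ring

/-- For odd n the integer n - 2l is nonzero, so the angle 2πl/n stays at distance at least π/n from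
π. -/
theorem cos_add_cos_nonneg (hodd : Odd n) (l : Fin n) :
    0 ≤ cos (π / n) + cos (((l : ℕ) : ℝ) * (2 * π / n)) := by
  obtain ⟨m, hm⟩ := hodd
  have hn : (0 : ℝ) < n := Nat.cast_pos.2 (Nat.pos_of_ne_zero (NeZero.ne n))
  have hl := l.2
  have hp := Real.pi_pos
  have key : cos (((l : ℕ) : ℝ) * (2 * π / n)) = -cos (|(n : ℝ) - 2 * (l : ℕ)| * (π / n)) := by
    rw [← Real.cos_pi_sub]
    rcases abs_cases ((n : ℝ) - 2 * (l : ℕ)) with ⟨h, -⟩ | ⟨h, -⟩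
    · rw [h]; congr 1; field_simp; ring
    · rw [h, ← Real.cos_two_pi_sub]; congr 1; field_simp; ring
  have h1 : (1 : ℝ) ≤ |(n : ℝ) - 2 * (l : ℕ)| := by
    have : (1 : ℤ) ≤ |(n : ℤ) - 2 * (l : ℕ)| := Int.one_le_abs (by omega)
    exact_mod_cast this
  have h2 : |(n : ℝ) - 2 * (l : ℕ)| ≤ n := by
    rw [abs_le]
    have : ((l : ℕ) : ℝ) ≤ n := by exact_mod_cast hl.le
    constructor <;> linarith [(Nat.cast_nonneg (l : ℕ) : (0 : ℝ) ≤ _)]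
  rw [key, ← sub_eq_add_neg, sub_nonneg]
  refine Real.cos_le_cos_of_nonneg_of_le_pi (by positivity) ?_ ?_
  · calc |(n : ℝ) - 2 * (l : ℕ)| * (π / n) ≤ n * (π / n) := by gcongr
      _ = π := by field_simp
  · calc π / n = 1 * (π / n) := (one_mul _).symm
      _ ≤ _ := by gcongr

theorem posSemidef_ringMatrix (hodd : Odd n) :
    (ringMatrix (2 * cos (π / n)) 1 : Matrix (Fin n) (Fin n) ℝ).PosSemidef := by
  have hH := isHermitian_ringMatrix (n := n) (2 * cos (π / n)) 1
  rw [hH.posSemidef_iff_eigenvalues_nonneg]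
  intro j
  have hmem : hH.eigenvalues j ∈
      (ringMatrix (2 * cos (π / n)) 1 : Matrix (Fin n) (Fin n) ℝ).charpoly.roots := by
    rw [hH.roots_charpoly_eq_eigenvalues]
    exact Multiset.mem_map_of_mem _ (Finset.mem_univ j)
  rw [charpoly_ringMatrix, Polynomial.mem_roots', Polynomial.IsRoot.def,
    Polynomial.eval_prod, Finset.prod_eq_zero_iff] at hmem
  obtain ⟨-, l, -, hl⟩ := hmem
  rw [Polynomial.eval_sub, Polynomial.eval_X, Polynomial.eval_C, sub_eq_zero] at hl
  rw [hl]
  have := cos_add_cos_nonneg hodd l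
  simp only [Pi.zero_apply]
  linarith

theorem dotProduct_ringMatrix_mulVec (a b : ℝ) (x : Fin n → ℝ) :
    x ⬝ᵥ (ringMatrix a b).mulVec x = a * ∑ i, x i ^ 2 + 2 * b * ∑ i, x i * x (i + 1) := by
  have h : ∑ i, x i * x (i - 1) = ∑ i, x i * x (i + 1) := by
    rw [← sum_add_one fun i => x i * x (i - 1)]
    simp [mul_comm]
  simp only [dotProduct, ringMatrix_mulVec]
  calc ∑ i, x i * (a * x i + b * (x (i - 1) + x (i + 1)))
      = a * ∑ i, x i ^ 2 + b * ∑ i, x i * x (i - 1) + b * ∑ i, x i * x (i + 1) := by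
        simp only [Finset.mul_sum, ← Finset.sum_add_distrib]
        exact Finset.sum_congr rfl fun i _ => by ring
    _ = _ := by rw [h]; ring

/-! ### The minimum of the potential -/

/-- The unit-norm constraints turn the quadratic form, summed over the three coordinate functions,
into an affine function of the potential; this transfers spectral bounds to V. -/
theorem sum_coords_form (a b : ℝ) (Γ : State n) :
    ∑ k : Fin 3, (fun i => (Γ i : E3) k) ⬝ᵥ (ringMatrix a b).mulVec (fun i => (Γ i : E3) k) =
      a * n + 2 * b * potential Γ := by
  simp only [dotProduct_ringMatrix_mulVec, Fin.sum_univ_three]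
  have h1 : ∑ i, (Γ i : E3) 0 ^ 2 + ∑ i, (Γ i : E3) 1 ^ 2 + ∑ i, (Γ i : E3) 2 ^ 2 = n := by
    rw [← Finset.sum_add_distrib, ← Finset.sum_add_distrib]
    simp [coords_sphere]
  have h2 : potential Γ = ∑ i, (Γ i : E3) 0 * (Γ (i + 1) : E3) 0 +
      ∑ i, (Γ i : E3) 1 * (Γ (i + 1) : E3) 1 + ∑ i, (Γ i : E3) 2 * (Γ (i + 1) : E3) 2 := by
    rw [← Finset.sum_add_distrib, ← Finset.sum_add_distrib]
    simp [potential, edgeCos, inner_eq_coords]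
  rw [h2]
  linear_combination a * h1

theorem cos_pi_sub_pi_div (n : ℕ) : cos (π - π / n) = -cos (π / n) := Real.cos_pi_sub _

theorem le_potential (hodd : Odd n) (Γ : State n) : n * cos (π - π / n) ≤ potential Γ := by
  have h := sum_coords_form (2 * cos (π / n)) 1 Γ
  have h0 : 0 ≤ ∑ k : Fin 3, (fun i => (Γ i : E3) k) ⬝ᵥ
      (ringMatrix (2 * cos (π / n)) 1).mulVec (fun i => (Γ i : E3) k) :=
    Finset.sum_nonneg fun k _ => by
      simpa using (posSemidef_ringMatrix hodd).dotProduct_mulVec_nonneg (fun i => (Γ i : E3) k)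
  rw [cos_pi_sub_pi_div]
  linarith

/-- The deviations g_i - c alternate in sign along the ring. Their product over an odd cycle equals
its own negative, so one of them vanishes, and all have the same square. -/
theorem eq_of_add_eq (hodd : Odd n) {g : Fin n → ℝ} {c : ℝ} (h : ∀ i, g (i - 1) + g i = 2 * c)
    (i : Fin n) : g i = c := by
  have h1 : ∀ i, g (i + 1) - c = -(g i - c) := fun i => by
    have := h (i + 1)
    rw [add_sub_cancel_right] at this
    linarith
  have hsq : ∀ i, (g i - c) ^ 2 = (g 0 - c) ^ 2 := fun i => by
    induction i using cyclic_induction with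
    | h0 => rfl
    | hs i ih => rw [h1, neg_sq, ih]
  have hprod : ∏ i, (g i - c) = 0 := by
    have h2 : ∏ i, (g (i + 1) - c) = ∏ i, (g i - c) :=
      Equiv.prod_comp (Equiv.addRight 1) fun i => g i - c
    simp only [h1, Finset.prod_neg, Finset.card_univ, Fintype.card_fin, hodd.neg_one_pow] at h2
    linarith
  obtain ⟨j, -, hj⟩ := Finset.prod_eq_zero_iff.1 hprod
  have := hsq i
  rw [← hsq j, hj] at this
  simpa [sub_eq_zero] using this

/-- Equality in the semidefinite bound puts each coordinate function in the kernel of the matrix,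
which says that every neighbour sum is -2 cos(π/n) Γ_i. -/
theorem equilibrium_of_potential_eq (hn : 3 ≤ n) (hodd : Odd n) {Γ : State n}
    (h : potential Γ = n * cos (π - π / n)) :
    Γ ∈ equilibriumSet (undirectedRing n) ∧ ∀ i, edgeCos Γ i = cos (π - π / n) := by
  rw [cos_pi_sub_pi_div] at *
  have hsum := sum_coords_form (2 * cos (π / n)) 1 Γ
  rw [h] at hsum
  have hpsd := posSemidef_ringMatrix (n := n) hodd
  have hz : ∀ k : Fin 3, (fun i => (Γ i : E3) k) ⬝ᵥ
      (ringMatrix (2 * cos (π / n)) 1).mulVec (fun i => (Γ i : E3) k) = 0 := by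
    have := (Finset.sum_eq_zero_iff_of_nonneg fun (k : Fin 3) _ => by
      simpa using hpsd.dotProduct_mulVec_nonneg (fun i => (Γ i : E3) k)).1
        (hsum.trans (by ring))
    exact fun k => this k (Finset.mem_univ k)
  have hs : ∀ i, neighbourSum Γ i = (2 * -cos (π / n)) • (Γ i : E3) := by
    intro i
    ext k
    have h1 := (hpsd.dotProduct_mulVec_zero_iff (fun i => (Γ i : E3) k)).1 (by simpa using hz k)
    have h2 := congrFun h1 i
    rw [ringMatrix_mulVec] at h2
    simp [neighbourSum] at h2 ⊢
    linarith
  refine ⟨mem_equilibriumSet_of_smul hn hs, eq_of_add_eq hodd fun i => ?_⟩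
  rw [← inner_neighbourSum, hs, inner_smul_right, inner_self_sphere, mul_one]

end Spectrum

/-! ### The cyclic formation -/

/-- The function s ↦ exp(-sA)(cos s · P + sin s · AP) has zero derivative and equals P at 0. Only
A²P = -P is required, not A² = -1, which fails for `hat u`. -/
theorem exp_smul_mul_of_sq_eq_neg {𝔸 : Type*} [NormedRing 𝔸] [NormedAlgebra ℝ 𝔸]
    [CompleteSpace 𝔸] {A P : 𝔸} (h : A * (A * P) = -P) (t : ℝ) :
    NormedSpace.exp (t • A) * P = cos t • P + sin t • (A * P) := by
  set G : ℝ → 𝔸 := fun s => NormedSpace.exp (s • -A) * (cos s • P + sin s • (A * P)) with hG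
  have hd : ∀ s, HasDerivAt G 0 s := by
    intro s
    have h1 := hasDerivAt_exp_smul_const (𝕂 := ℝ) (-A) s
    have h2 := ((Real.hasDerivAt_cos s).smul_const P).add
      ((Real.hasDerivAt_sin s).smul_const (A * P))
    have h3 : HasDerivAt G (NormedSpace.exp (s • -A) * -A * (cos s • P + sin s • (A * P)) +
        NormedSpace.exp (s • -A) * (-sin s • P + cos s • (A * P))) s := h1.mul h2
    convert h3 using 1
    simp only [mul_add, mul_smul_comm, mul_assoc, neg_mul, mul_neg, h, neg_smul,
      smul_neg, neg_neg]
    abel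
  have hc : G t = G 0 := is_const_of_deriv_eq_zero (fun s => (hd s).differentiableAt)
    (fun s => (hd s).deriv) t 0
  have h0 : G 0 = P := by simp [hG]
  rw [h0] at hc
  have hcomm : Commute (t • A) (t • -A) := by simp
  let _ : NormedAlgebra ℚ 𝔸 := NormedAlgebra.restrictScalars ℚ ℝ 𝔸
  have hexp := NormedSpace.exp_add_of_commute hcomm
  rw [smul_neg, add_neg_cancel, NormedSpace.exp_zero, ← smul_neg] at hexp
  rw [← one_mul (cos t • P + _), hexp, mul_assoc]
  exact congrArg _ hc.symm

open scoped Matrix.Norms.Operator in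
theorem matrix_exp_smul_mul_of_sq_eq_neg {A P : Matrix (Fin 3) (Fin 3) ℝ}
    (h : A * (A * P) = -P) (t : ℝ) :
    NormedSpace.exp (t • A) * P = cos t • P + sin t • (A * P) :=
  exp_smul_mul_of_sq_eq_neg h t

theorem act_exp_hat {u v : S2} (huv : inner ℝ (u : E3) (v : E3) = 0) (t : ℝ) :
    act (NormedSpace.exp (t • hat (u : E3))) v = cos t • (v : E3) + sin t • cross u v := by
  -- A vector is encoded as a matrix with three equal columns, so that the identity in the matrix
  -- algebra applies to it.
  have hvec : ∀ (B : Matrix (Fin 3) (Fin 3) ℝ) (x : E3),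
      B * Matrix.vecMulVec x (fun _ : Fin 3 => 1) = Matrix.vecMulVec (act B x) fun _ => 1 := by
    intro B x
    rw [Matrix.mul_vecMulVec]; rfl
  have h := matrix_exp_smul_mul_of_sq_eq_neg (A := hat (u : E3))
    (P := Matrix.vecMulVec (v : E3) (fun _ : Fin 3 => 1)) (by
      rw [hvec, hvec]
      change Matrix.vecMulVec (cross (u : E3) (cross u v)) _ = _
      rw [cross_cross, inner_self_sphere, huv]
      ext i j
      simp [Matrix.vecMulVec]) t
  rw [hvec, hvec] at h
  ext i
  have := congrFun (congrFun h i) 0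
  simpa [Matrix.vecMulVec, cross] using this

section Formation

variable {n : ℕ}

theorem mem_cyclicFormation_iff {Γ : State n} :
    Γ ∈ cyclicFormation n ↔ ∃ v w : S2, inner ℝ (v : E3) (w : E3) = 0 ∧ ∀ i : Fin n,
      (Γ i : E3) = cos (((i : ℕ) : ℝ) * (π - π / n)) • (v : E3) +
        sin (((i : ℕ) : ℝ) * (π - π / n)) • (w : E3) := by
  constructor
  · rintro ⟨u, v, huv, h⟩
    refine ⟨v, unitOf (cross u v) ?_, inner_cross_right _ _, fun i => ?_⟩
    · rw [inner_cross_cross, inner_self_sphere, inner_self_sphere, huv]; simp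
    · rw [h, act_exp_hat huv]; rfl
  · rintro ⟨v, w, hvw, h⟩
    have hu : inner ℝ (cross (v : E3) w) (cross (v : E3) w) = 1 := by
      rw [inner_cross_cross, inner_self_sphere, inner_self_sphere, hvw]; simp
    have huv : inner ℝ (unitOf _ hu : E3) (v : E3) = 0 := by
      rw [real_inner_comm]; exact inner_cross_left _ _
    refine ⟨unitOf _ hu, v, huv, fun i => ?_⟩
    have hw : cross (unitOf _ hu : E3) v = w := by
      change cross (cross (v : E3) w) v = w
      rw [cross_swap, cross_cross, inner_self_sphere, hvw]
      simp
    rw [h, act_exp_hat huv, hw]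

theorem cyclicFormation_rotate {Γ Γ' : State n} (h : Γ ∈ cyclicFormation n)
    (h' : Γ' ∈ rotationOrbit Γ) : Γ' ∈ cyclicFormation n := by
  obtain ⟨v, w, hvw, h⟩ := mem_cyclicFormation_iff.1 h
  obtain ⟨R, hR, h'⟩ := h'
  refine mem_cyclicFormation_iff.2 ⟨unitOf (act R v) (by rw [inner_act_act hR]; simp),
    unitOf (act R w) (by rw [inner_act_act hR]; simp), ?_, fun i => ?_⟩
  · exact (inner_act_act hR _ _).trans hvw
  · rw [h', h, act_add, act_smul, act_smul]; rfl

theorem cyclicFormation_nonempty : (cyclicFormation n).Nonempty := by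
  obtain ⟨w, hw⟩ := exists_orthogonal_unit (unitOf !₂[1, 0, 0] (by rw [inner_eq_coords]; simp))
  set v := unitOf !₂[1, 0, 0] (by rw [inner_eq_coords]; simp)
  refine ⟨fun i => unitOf (cos (((i : ℕ) : ℝ) * (π - π / n)) • (v : E3) +
        sin (((i : ℕ) : ℝ) * (π - π / n)) • (w : E3)) ?_,
    mem_cyclicFormation_iff.2 ⟨v, w, hw, fun i => rfl⟩⟩
  rw [inner_add_left, inner_add_right, inner_add_right]
  simp only [inner_smul_left, inner_smul_right, inner_self_sphere, hw, real_inner_comm (v : E3) w]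
  have h3 := Real.sin_sq_add_cos_sq ((i : ℕ) * (π - π / n))
  simp
  linear_combination h3

variable [NeZero n]

/-- For n = 2m + 1 the total angle n(π - π/n) is m full turns, so the step rule also holds across
the wrap from n - 1 to 0. -/
theorem sin_cos_val_add_one (hodd : Odd n) (i : Fin n) :
    cos (((i + 1 : Fin n) : ℕ) * (π - π / n)) = cos ((i : ℕ) * (π - π / n) + (π - π / n)) ∧
    sin (((i + 1 : Fin n) : ℕ) * (π - π / n)) = sin ((i : ℕ) * (π - π / n) + (π - π / n)) := by
  obtain ⟨m, hm⟩ := hodd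
  have hn : (n : ℝ) ≠ 0 := Nat.cast_ne_zero.2 (NeZero.ne n)
  have hper : (n : ℝ) * (π - π / n) = m * (2 * π) := by
    have : (n : ℝ) = 2 * m + 1 := by exact_mod_cast hm
    rw [mul_sub, mul_div_cancel₀ _ hn, this]; ring
  have hval : ((i : ℕ) : ℝ) + 1 = ((i + 1 : Fin n) : ℕ) + n * (((i : ℕ) + 1) / n : ℕ) := by
    rw [Fin.val_add, Fin.val_one', Nat.add_mod_mod]
    exact_mod_cast (Nat.mod_add_div ((i : ℕ) + 1) n).symm
  have hang : (i : ℕ) * (π - π / n) + (π - π / n) =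
      ((i + 1 : Fin n) : ℕ) * (π - π / n) + ((((i : ℕ) + 1) / n * m : ℕ) : ℝ) * (2 * π) := by
    push_cast
    linear_combination (π - π / n) * hval + (((i : ℕ) + 1) / n : ℕ) * hper
  rw [hang, Real.cos_add_nat_mul_two_pi, Real.sin_add_nat_mul_two_pi]
  exact ⟨rfl, rfl⟩

theorem cos_neighbours (hodd : Odd n) (i : Fin n) :
    cos (((i - 1 : Fin n) : ℕ) * (π - π / n)) + cos (((i + 1 : Fin n) : ℕ) * (π - π / n)) =
      2 * cos (π - π / n) * cos ((i : ℕ) * (π - π / n)) := by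
  have h1 := sin_cos_val_add_one hodd i
  have h2 := sin_cos_val_add_one hodd (i - 1)
  rw [sub_add_cancel] at h2
  rw [h1.1, Real.cos_add, h2.1, h2.2, Real.cos_add, Real.sin_add]
  have h3 := Real.sin_sq_add_cos_sq (π - π / n)
  linear_combination -cos (((i - 1 : Fin n) : ℕ) * (π - π / n)) * h3

theorem edgeCos_of_mem_cyclicFormation (hodd : Odd n) {Γ : State n} (h : Γ ∈ cyclicFormation n)
    (i : Fin n) : edgeCos Γ i = cos (π - π / n) := by
  obtain ⟨v, w, hvw, h⟩ := mem_cyclicFormation_iff.1 h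
  obtain ⟨hc, hs⟩ := sin_cos_val_add_one hodd i
  rw [edgeCos, h, h, hc, hs, inner_add_left, inner_add_right, inner_add_right]
  simp only [inner_smul_left, inner_smul_right, inner_self_sphere, hvw, real_inner_comm (v : E3) w]
  generalize π - π / n = β
  rw [Real.cos_add, Real.sin_add]
  have h3 := Real.sin_sq_add_cos_sq ((i : ℕ) * β)
  simp
  linear_combination cos β * h3

theorem potential_of_mem_cyclicFormation (hodd : Odd n) {Γ : State n}
    (h : Γ ∈ cyclicFormation n) : potential Γ = n * cos (π - π / n) := by
  simp [potential, edgeCos_of_mem_cyclicFormation hodd h]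

theorem mem_cyclicFormation_iff_potential (hn : 3 ≤ n) (hodd : Odd n) {Γ : State n} :
    Γ ∈ cyclicFormation n ↔ potential Γ = n * cos (π - π / n) := by
  refine ⟨potential_of_mem_cyclicFormation hodd, fun h => ?_⟩
  obtain ⟨Γ₀, h₀⟩ := cyclicFormation_nonempty (n := n)
  obtain ⟨he, hg⟩ := equilibrium_of_potential_eq hn hodd h
  obtain ⟨he₀, hg₀⟩ := equilibrium_of_potential_eq hn hodd
    (potential_of_mem_cyclicFormation hodd h₀)
  refine cyclicFormation_rotate h₀ (mem_rotationOrbit_of_edgeCos_eq hn he₀ he ?_)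
  funext i
  rw [hg, hg₀]

theorem cyclicFormation_subset_equilibriumSet (hn : 3 ≤ n) (hodd : Odd n) :
    cyclicFormation n ⊆ equilibriumSet (undirectedRing n) := fun _ h =>
  (equilibrium_of_potential_eq hn hodd (potential_of_mem_cyclicFormation hodd h)).1

theorem cyclicFormation_eq_rotationOrbit (hn : 3 ≤ n) (hodd : Odd n) {Γ : State n}
    (h : Γ ∈ cyclicFormation n) : cyclicFormation n = rotationOrbit Γ := by
  refine Subset.antisymm (fun Γ' h' => ?_) fun Γ' h' => cyclicFormation_rotate h h'
  refine mem_rotationOrbit_of_edgeCos_eq hn (cyclicFormation_subset_equilibriumSet hn hodd h)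
    (cyclicFormation_subset_equilibriumSet hn hodd h') (funext fun i => ?_)
  rw [edgeCos_of_mem_cyclicFormation hodd h, edgeCos_of_mem_cyclicFormation hodd h']

theorem isEquilibriumManifold_cyclicFormation (hn : 3 ≤ n) (hodd : Odd n) :
    IsEquilibriumManifold (undirectedRing n) (cyclicFormation n) := by
  obtain ⟨Γ, h⟩ := cyclicFormation_nonempty (n := n)
  rw [cyclicFormation_eq_rotationOrbit hn hodd h]
  exact isEquilibriumManifold_rotationOrbit hn hodd (cyclicFormation_subset_equilibriumSet hn hodd h)

end Formation

/-! ### Global existence of trajectories -/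

/-- A field bounded by L moves a point by at most L(N + 1) in time N + 1, so Picard–Lindelöf applies
on every [0, N + 1]; uniqueness makes these solutions agree and they are glued. -/
theorem exists_global_solution {E : Type*} [NormedAddCommGroup E] [NormedSpace ℝ E]
    [CompleteSpace E] {f : E → E} {K L : NNReal} (hf : LipschitzWith K f) (hL : ∀ x, ‖f x‖ ≤ L)
    (x₀ : E) :
    ∃ γ : ℝ → E, γ 0 = x₀ ∧ ∀ t, 0 ≤ t → HasDerivWithinAt γ (f (γ t)) (Ici 0) t := by
  have hloc : ∀ N : ℕ, ∃ α : ℝ → E, α 0 = x₀ ∧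
      ∀ t ∈ Icc (0 : ℝ) (N + 1), HasDerivWithinAt α (f (α t)) (Icc 0 (N + 1)) t := by
    intro N
    have h0 : (0 : ℝ) ∈ Icc (0 : ℝ) (N + 1) := ⟨le_rfl, by positivity⟩
    have hpl : IsPicardLindelof (fun _ => f) (tmin := 0) (tmax := N + 1) ⟨0, h0⟩ x₀
        (L * (N + 1)) 0 L K :=
      { lipschitzOnWith := fun _ _ => hf.lipschitzOnWith
        continuousOn := fun _ _ => continuousOn_const
        norm_le := fun _ _ x _ => hL x
        mul_max_le := by
          have : (0 : ℝ) ≤ N + 1 := by positivity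
          simp [this] }
    exact hpl.exists_eq_forall_mem_Icc_hasDerivWithinAt₀
  choose α hα0 hα using hloc
  have hright : ∀ N : ℕ, ∀ t ∈ Ico (0 : ℝ) (N + 1),
      HasDerivWithinAt (α N) (f (α N t)) (Ici t) t := fun N t ht =>
    ((hα N t (Ico_subset_Icc_self ht)).mono (Icc_subset_Icc_left ht.1)).mono_of_mem_nhdsWithin
      (Icc_mem_nhdsGE ht.2)
  have huniq : ∀ M N : ℕ, M ≤ N → EqOn (α M) (α N) (Icc 0 (M + 1)) := by
    intro M N hMN
    have hle : (M : ℝ) + 1 ≤ N + 1 := by exact_mod_cast Nat.succ_le_succ hMN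
    refine ODE_solution_unique (v := fun _ => f) (K := K) (fun _ => hf)
      (fun t ht => (hα M t ht).continuousWithinAt) (hright M)
      (fun t ht => ((hα N t (Icc_subset_Icc_right hle ht)).continuousWithinAt).mono
        (Icc_subset_Icc_right hle))
      (fun t ht => hright N t (Ico_subset_Ico_right hle ht)) ?_
    rw [hα0, hα0]
  refine ⟨fun t => α ⌊t⌋₊ t, by simp [hα0], fun t ht => ?_⟩
  have hlt : t < (⌊t⌋₊ : ℝ) + 1 := Nat.lt_floor_add_one t
  have heq : ∀ s ∈ Ico (0 : ℝ) (⌊t⌋₊ + 1), α ⌊s⌋₊ s = α ⌊t⌋₊ s := fun s hs => by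
    refine huniq _ _ ?_ ⟨hs.1, (Nat.lt_floor_add_one s).le⟩
    have : ⌊s⌋₊ < ⌊t⌋₊ + 1 := (Nat.floor_lt hs.1).2 (by push_cast; exact hs.2)
    omega
  have hd := (hα ⌊t⌋₊ t ⟨ht, hlt.le⟩).mono Ico_subset_Icc_self
  refine (hd.congr heq rfl).mono_of_mem_nhdsWithin ?_
  rw [← Ici_inter_Iio]
  exact inter_mem_nhdsWithin _ (Iio_mem_nhds hlt)

theorem IsTrajectory.continuousOn {n : ℕ} {Γ : ℝ → State n} {N : Fin n → Finset (Fin n)}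
    (h : IsTrajectory N Γ) :
    ContinuousOn Γ (Ici 0) := by
  refine continuousOn_pi.2 fun i => ?_
  rw [Topology.IsInducing.subtypeVal.continuousOn_iff]
  exact fun t ht => (h t ht i).continuousWithinAt

section Dynamics

variable {n : ℕ} [NeZero n]

/-- The polynomial extension of the closed-loop vector field to `(ℝ³)ⁿ` that is tangent to all
spheres. -/
noncomputable def ambientField (x : Fin n → E3) (i : Fin n) : E3 :=
  inner ℝ (x i) (x (i - 1) + x (i + 1)) • x i - inner ℝ (x i) (x i) • (x (i - 1) + x (i + 1))

theorem contDiff_ambientField : ContDiff ℝ 1 (ambientField : (Fin n → E3) → Fin n → E3) := by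
  unfold ambientField
  refine contDiff_pi.2 fun i => ?_
  have h1 : ContDiff ℝ 1 fun x : Fin n → E3 => x i := by fun_prop
  have h2 : ContDiff ℝ 1 fun x : Fin n → E3 => x (i - 1) + x (i + 1) := by fun_prop
  exact ((h1.inner ℝ h2).smul h1).sub ((h1.inner ℝ h1).smul h2)

theorem inner_ambientField (x : Fin n → E3) (i : Fin n) :
    inner ℝ (x i) (ambientField x i) = 0 := by
  simp only [ambientField, inner_sub_right, inner_smul_right]
  ring

theorem ambientField_eq_velocity (hn : 3 ≤ n) (Γ : State n) (i : Fin n) :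
    ambientField (fun j => (Γ j : E3)) i = velocity (undirectedRing n) Γ i := by
  rw [velocity_eq hn, ambientField, inner_self_sphere, one_smul]; rfl

theorem exists_trajectory (hn : 3 ≤ n) (Γ₀ : State n) :
    ∃ Γ : ℝ → State n, IsTrajectory (undirectedRing n) Γ ∧ Γ 0 = Γ₀ := by
  -- The cut-off equals 1 on the closed unit ball of the sup norm, which contains the product of
  -- spheres. The cut-off field is still tangent, so solutions starting there stay there.
  let χ : ContDiffBump (0 : Fin n → E3) := ⟨1, 2, one_pos, one_lt_two⟩
  set f : (Fin n → E3) → Fin n → E3 := fun x => χ x • ambientField x with hf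
  have hfc : ContDiff ℝ 1 f := χ.contDiff.smul contDiff_ambientField
  have hfs : HasCompactSupport f := χ.hasCompactSupport.smul_right
  obtain ⟨K, hK⟩ := ContDiff.lipschitzWith_of_hasCompactSupport hfs hfc one_ne_zero
  obtain ⟨L, hL⟩ := hfs.exists_bound_of_continuous hfc.continuous
  obtain ⟨γ, hγ0, hγ⟩ := exists_global_solution (L := L.toNNReal) hK
    (fun x => (hL x).trans (Real.le_coe_toNNReal L)) (fun i => (Γ₀ i : E3))
  have hγi : ∀ t, 0 ≤ t → ∀ i, HasDerivWithinAt (fun s => γ s i) (f (γ t) i) (Ici 0) t :=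
    fun t ht => hasDerivWithinAt_pi.1 (hγ t ht)
  have hunit : ∀ t, 0 ≤ t → ∀ i, inner ℝ (γ t i) (γ t i) = 1 := by
    intro t ht i
    have hd : ∀ s, 0 ≤ s → HasDerivWithinAt (fun s => inner ℝ (γ s i) (γ s i)) 0 (Ici 0) s := by
      intro s hs
      have h := (hγi s hs i).inner ℝ (hγi s hs i)
      have h0 : inner ℝ (γ s i) (f (γ s) i) = 0 := by
        simp [hf, inner_smul_right, inner_ambientField]
      rwa [real_inner_comm (γ s i) (f (γ s) i), h0, add_zero] at h
    have hconst := constant_of_has_deriv_right_zero (a := 0) (b := t)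
      (f := fun s => inner ℝ (γ s i) (γ s i))
      (fun s hs => (hd s hs.1).continuousWithinAt.mono Icc_subset_Ici_self)
      (fun s hs => (hd s hs.1).mono (Ici_subset_Ici.2 hs.1)) t ⟨ht, le_rfl⟩
    simpa [hγ0] using hconst
  refine ⟨fun t i => if h : inner ℝ (γ t i) (γ t i) = 1 then unitOf (γ t i) h else Γ₀ i, ?_, ?_⟩
  · have hval : ∀ t, 0 ≤ t → ∀ i, (((if h : inner ℝ (γ t i) (γ t i) = 1 then unitOf (γ t i) h
        else Γ₀ i : S2)) : E3) = γ t i := fun t ht i => by rw [dif_pos (hunit t ht i)]; rfl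
    intro t ht i
    have hfield : f (γ t) i = ambientField (γ t) i := by
      have h1 : χ (γ t) = 1 := by
        refine χ.one_of_mem_closedBall ?_
        rw [mem_closedBall_zero_iff, pi_norm_le_iff_of_nonneg zero_le_one]
        intro j
        have := hunit t ht j
        rw [real_inner_self_eq_norm_sq] at this
        exact ((pow_eq_one_iff_of_nonneg (norm_nonneg _) two_ne_zero).1 this).le
      simp [hf, h1]
    rw [← ambientField_eq_velocity hn]
    simp only [hval t ht]
    rw [← hfield]
    exact (hγi t ht i).congr (fun s hs => hval s hs i) (hval t ht i)
  · funext i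
    apply Subtype.ext
    change ((if h : inner ℝ (γ 0 i) (γ 0 i) = 1 then unitOf (γ 0 i) h else Γ₀ i : S2) : E3) = _
    rw [dif_pos (hunit 0 le_rfl i)]
    simp [unitOf, hγ0]

/-! ### The potential along trajectories -/

variable {Γ : ℝ → State n}

theorem norm_velocity_le (hn : 3 ≤ n) (Γ : State n) (i : Fin n) :
    ‖velocity (undirectedRing n) Γ i‖ ≤ 4 := by
  have hs : ‖neighbourSum Γ i‖ ≤ 2 := by
    refine (norm_add_le _ _).trans ?_
    rw [norm_eq_of_mem_sphere, norm_eq_of_mem_sphere]; norm_num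
  rw [velocity_eq hn]
  refine (norm_sub_le _ _).trans ?_
  rw [norm_smul, norm_eq_of_mem_sphere, mul_one]
  have := norm_inner_le_norm (𝕜 := ℝ) (Γ i : E3) (neighbourSum Γ i)
  rw [norm_eq_of_mem_sphere, one_mul] at this
  linarith

theorem IsTrajectory.dist_le (hn : 3 ≤ n) (h : IsTrajectory (undirectedRing n) Γ) {s t : ℝ}
    (hs : 0 ≤ s) (ht : 0 ≤ t) : dist (Γ s) (Γ t) ≤ 4 * |s - t| := by
  refine (dist_pi_le_iff (by positivity)).2 fun i => ?_
  rw [Subtype.dist_eq, dist_eq_norm]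
  exact (convex_Ici (0 : ℝ)).norm_image_sub_le_of_norm_hasDerivWithin_le
    (fun r hr => h r hr i) (fun r _ => norm_velocity_le hn (Γ r) i) ht hs

/-- The dissipation rate of the potential. -/
noncomputable def dissipation (Γ : State n) : ℝ := ∑ i, ‖velocity (undirectedRing n) Γ i‖ ^ 2

theorem continuous_dissipation (hn : 3 ≤ n) : Continuous (dissipation : State n → ℝ) := by
  unfold dissipation
  have := continuous_velocity (n := n) hn
  fun_prop

theorem dissipation_nonneg (Γ : State n) : 0 ≤ dissipation Γ :=
  Finset.sum_nonneg fun _ _ => sq_nonneg _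

theorem dissipation_pos {Γ : State n} (h : Γ ∉ equilibriumSet (undirectedRing n)) :
    0 < dissipation Γ := by
  refine lt_of_le_of_ne (dissipation_nonneg Γ) fun h0 => h fun i => ?_
  have := (Finset.sum_eq_zero_iff_of_nonneg fun i _ => sq_nonneg _).1 h0.symm i (Finset.mem_univ i)
  simpa using this

/-- After reindexing, the derivative of V is the sum of the pairings of each velocity with its
neighbour sum, and only the tangential part of the latter, minus the velocity, contributes. -/
theorem sum_inner_velocity (hn : 3 ≤ n) (Γ : State n) :
    ∑ i, (inner ℝ (Γ i : E3) (velocity (undirectedRing n) Γ (i + 1)) +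
      inner ℝ (velocity (undirectedRing n) Γ i) (Γ (i + 1) : E3)) = -dissipation Γ := by
  have h1 : ∑ i, inner ℝ (Γ i : E3) (velocity (undirectedRing n) Γ (i + 1)) =
      ∑ i, inner ℝ (velocity (undirectedRing n) Γ i) (Γ (i - 1) : E3) := by
    rw [← sum_add_one fun i => inner ℝ (velocity (undirectedRing n) Γ i) (Γ (i - 1) : E3)]
    simp [real_inner_comm]
  rw [Finset.sum_add_distrib, h1, ← Finset.sum_add_distrib, dissipation, ← Finset.sum_neg_distrib]
  refine Finset.sum_congr rfl fun i _ => ?_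
  rw [← inner_add_right]
  change inner ℝ _ (neighbourSum Γ i) = _
  have h2 : inner ℝ (velocity (undirectedRing n) Γ i) (Γ i : E3) = 0 := by
    rw [velocity_eq hn, inner_sub_left, inner_smul_left, inner_self_sphere,
      real_inner_comm (Γ i : E3) (neighbourSum Γ i)]
    simp
  have h3 : neighbourSum Γ i = inner ℝ (Γ i : E3) (neighbourSum Γ i) • (Γ i : E3) -
      velocity (undirectedRing n) Γ i := by rw [velocity_eq hn]; abel
  rw [h3, inner_sub_right, inner_smul_right, h2, real_inner_self_eq_norm_sq]
  ring

theorem IsTrajectory.hasDerivWithinAt_potential (hn : 3 ≤ n)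
    (h : IsTrajectory (undirectedRing n) Γ) {t : ℝ} (ht : 0 ≤ t) :
    HasDerivWithinAt (fun s => potential (Γ s)) (-dissipation (Γ t)) (Ici 0) t := by
  rw [← sum_inner_velocity hn]
  unfold potential edgeCos
  exact HasDerivWithinAt.fun_sum fun i _ => (h t ht i).inner ℝ (h t ht (i + 1))

theorem IsTrajectory.potential_sub_le (hn : 3 ≤ n) (h : IsTrajectory (undirectedRing n) Γ)
    {a b m : ℝ} (ha : 0 ≤ a) (hab : a ≤ b) (hm : ∀ t ∈ Icc a b, m ≤ dissipation (Γ t)) :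
    potential (Γ b) - potential (Γ a) ≤ -m * (b - a) := by
  have hd : ∀ t ∈ interior (Icc a b),
      HasDerivAt (fun s => potential (Γ s)) (-dissipation (Γ t)) t := by
    intro t ht
    rw [interior_Icc] at ht
    exact (h.hasDerivWithinAt_potential hn (ha.trans ht.1.le)).hasDerivAt
      (Ici_mem_nhds (ha.trans_lt ht.1))
  refine (convex_Icc a b).image_sub_le_mul_sub_of_deriv_le
    (fun t ht => (h.hasDerivWithinAt_potential hn (ha.trans ht.1)).continuousWithinAt.mono
      (Icc_subset_Ici_self.trans (Ici_subset_Ici.2 ha)))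
    (fun t ht => (hd t ht).differentiableAt.differentiableWithinAt) (fun t ht => ?_)
    a (left_mem_Icc.2 hab) b (right_mem_Icc.2 hab) hab
  rw [(hd t ht).deriv]
  exact neg_le_neg (hm t (interior_subset ht))

theorem IsTrajectory.potential_antitone (hn : 3 ≤ n) (h : IsTrajectory (undirectedRing n) Γ)
    {a b : ℝ} (ha : 0 ≤ a) (hab : a ≤ b) : potential (Γ b) ≤ potential (Γ a) := by
  have := h.potential_sub_le hn ha hab (m := 0) fun t _ => dissipation_nonneg _
  linarith

theorem IsTrajectory.tendsto_potential_drop (hn : 3 ≤ n) (hodd : Odd n)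
    (h : IsTrajectory (undirectedRing n) Γ) (τ : ℝ) :
    Tendsto (fun t => potential (Γ t) - potential (Γ (t + τ))) atTop (𝓝 0) := by
  -- A trajectory is unconstrained at negative times, so time is clamped to make the potential
  -- antitone on all of ℝ.
  set f : ℝ → ℝ := fun t => potential (Γ (max t 0)) with hf
  have hanti : Antitone f := fun a b hab =>
    h.potential_antitone hn (le_max_right _ _) (max_le_max_right 0 hab)
  have hbdd : BddBelow (range f) := ⟨n * cos (π - π / n), by
    rintro _ ⟨t, rfl⟩
    exact le_potential hodd _⟩
  have h1 := tendsto_atTop_ciInf hanti hbdd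
  have h2 := h1.sub (h1.comp (tendsto_atTop_add_const_right atTop τ tendsto_id))
  rw [sub_self] at h2
  refine h2.congr' ?_
  filter_upwards [eventually_ge_atTop 0, eventually_ge_atTop (-τ)] with t h0 h1
  simp only [hf, Function.comp, id]
  rw [max_eq_left h0, max_eq_left (by linarith)]

/-- By compactness the dissipation is at least some m > 0 at distance ε/2 or more from the
equilibria. A trajectory at distance ε has speed at most 4, so it stays that far for time ε/8 and V
drops by mε/8; such drops eventually cease. -/
theorem IsTrajectory.tendsto_infDist_equilibriumSet (hn : 3 ≤ n) (hodd : Odd n)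
    (h : IsTrajectory (undirectedRing n) Γ) :
    Tendsto (fun t => Metric.infDist (Γ t) (equilibriumSet (undirectedRing n))) atTop (𝓝 0) := by
  set D := equilibriumSet (undirectedRing n) with hD
  have hne : D.Nonempty :=
    cyclicFormation_nonempty.mono (cyclicFormation_subset_equilibriumSet hn hodd)
  rw [Metric.tendsto_atTop]
  intro ε hε
  have hKc : IsCompact {Γ : State n | ε / 2 ≤ Metric.infDist Γ D} :=
    (isClosed_le continuous_const (Metric.continuous_infDist_pt D)).isCompact
  obtain ⟨m, hm0, hm⟩ := hKc.exists_forall_le' (continuous_dissipation hn).continuousOn (a := 0)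
    fun Γ hΓ => dissipation_pos fun hmem => by
      have h0 := Metric.infDist_zero_of_mem hmem
      have h1 : ε / 2 ≤ Metric.infDist Γ D := hΓ
      rw [hD, h0] at h1
      linarith
  have hτ : 0 < ε / 8 := by positivity
  obtain ⟨T, hT⟩ := (((h.tendsto_potential_drop hn hodd (ε / 8)).eventually_lt_const
    (mul_pos hm0 hτ)).and (eventually_ge_atTop 0)).exists_forall_of_atTop
  refine ⟨T, fun t ht => ?_⟩
  obtain ⟨h1, h0⟩ := hT t ht
  rw [Real.dist_0_eq_abs, abs_of_nonneg Metric.infDist_nonneg]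
  by_contra! hge
  have := h.potential_sub_le hn h0 (b := t + ε / 8) (by linarith) (m := m) fun s hs => hm _ (by
    have h2 := h.dist_le hn h0 (h0.trans hs.1)
    have h3 : |t - s| ≤ ε / 8 := by rw [abs_le]; constructor <;> linarith [hs.1, hs.2]
    have h4 := Metric.infDist_le_infDist_add_dist (s := D) (x := Γ t) (y := Γ s)
    change ε / 2 ≤ _
    linarith)
  rw [add_sub_cancel_left] at this
  linarith

/-! ### Convergence to a single orbit -/

theorem isCompact_rotationOrbit (hn : 3 ≤ n) {Γ : State n}
    (h : Γ ∈ equilibriumSet (undirectedRing n)) : IsCompact (rotationOrbit Γ) := by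
  rw [rotationOrbit_eq_fibre hn h]
  exact (isCompact_equilibriumSet hn).inter_right
    (isClosed_singleton.preimage continuous_edgeCos)

/-- The remaining orbits are the fibres over a finite, hence closed, set of edge-cosine vectors. -/
theorem isCompact_equilibriumSet_diff_rotationOrbit (hn : 3 ≤ n) (hodd : Odd n) {Γ : State n}
    (h : Γ ∈ equilibriumSet (undirectedRing n)) :
    IsCompact (equilibriumSet (undirectedRing n) \ rotationOrbit Γ) := by
  have : equilibriumSet (undirectedRing n) \ rotationOrbit Γ = equilibriumSet (undirectedRing n) ∩
      edgeCos ⁻¹' (edgeCos '' equilibriumSet (undirectedRing n) \ {edgeCos Γ}) := by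
    rw [rotationOrbit_eq_fibre hn h]
    ext Γ'
    constructor
    · rintro ⟨h1, h2⟩
      exact ⟨h1, mem_image_of_mem _ h1, fun h3 => h2 ⟨h1, h3⟩⟩
    · rintro ⟨h1, -, h2⟩
      exact ⟨h1, fun h3 => h2 h3.2⟩
  rw [this]
  exact (isCompact_equilibriumSet hn).inter_right
    (((finite_edgeCos_image hn hodd).subset sdiff_subset).isClosed.preimage continuous_edgeCos)

theorem potential_eq_of_mem_rotationOrbit {Γ Γ' : State n} (h : Γ' ∈ rotationOrbit Γ) :
    potential Γ' = potential Γ := by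
  rw [potential, potential, edgeCos_eq_of_mem_rotationOrbit h]

theorem tendsto_infDist_zero_iff {X : Type*} [PseudoMetricSpace X] {s : Set X} (hs : s.Nonempty)
    {f : ℝ → X} : Tendsto (fun t => Metric.infDist (f t) s) atTop (𝓝 0) ↔
      ∀ δ, 0 < δ → ∀ᶠ t in atTop, f t ∈ Metric.thickening δ s := by
  constructor
  · intro h δ hδ
    filter_upwards [h.eventually_lt_const hδ] with t ht
    exact (Metric.mem_thickening_iff_infDist_lt hs).2 ht
  · intro h
    rw [Metric.tendsto_atTop]
    intro ε hε
    obtain ⟨T, hT⟩ := (h ε hε).exists_forall_of_atTop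
    refine ⟨T, fun t ht => ?_⟩
    rw [Real.dist_0_eq_abs, abs_of_nonneg Metric.infDist_nonneg]
    exact (Metric.mem_thickening_iff_infDist_lt hs).1 (hT t ht)

theorem IsTrajectory.exists_limit_orbit (hn : 3 ≤ n) (hodd : Odd n)
    (h : IsTrajectory (undirectedRing n) Γ) :
    ∃ Γ' ∈ equilibriumSet (undirectedRing n), potential Γ' ≤ potential (Γ 0) ∧
      Tendsto (fun t => Metric.infDist (Γ t) (rotationOrbit Γ')) atTop (𝓝 0) := by
  have hlim := h.tendsto_infDist_equilibriumSet hn hodd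
  have hne : (equilibriumSet (undirectedRing n)).Nonempty :=
    cyclicFormation_nonempty.mono (cyclicFormation_subset_equilibriumSet hn hodd)
  -- A cluster point selects the limit orbit. Late on, the connected tail lies in two disjoint
  -- thickenings, of this orbit and of the other equilibria, and it meets the first.
  obtain ⟨Γ', hΓ'⟩ := exists_clusterPt_of_compactSpace (map Γ atTop)
  have hcl : MapClusterPt Γ' atTop Γ := hΓ'
  have hfreq := mapClusterPt_iff_frequently.1 hcl
  have hpot : potential Γ' ≤ potential (Γ 0) := by
    have hcl' : IsClosed {Γ'' : State n | potential Γ'' ≤ potential (Γ 0)} :=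
      isClosed_le continuous_potential continuous_const
    by_contra hnot
    obtain ⟨t, ht, h0⟩ := ((hfreq _ (hcl'.isOpen_compl.mem_nhds hnot)).and_eventually
      (eventually_ge_atTop 0)).exists
    exact ht (h.potential_antitone hn le_rfl h0)
  have hmem : Γ' ∈ equilibriumSet (undirectedRing n) := by
    by_contra hnot
    have hpos := ((isCompact_equilibriumSet hn).isClosed.notMem_iff_infDist_pos hne).1 hnot
    obtain ⟨t, h1, h2⟩ := ((hfreq _ ((isOpen_lt continuous_const (Metric.continuous_infDist_pt
      (equilibriumSet (undirectedRing n)))).mem_nhds (half_lt_self hpos))).and_eventually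
      (hlim.eventually_lt_const (half_pos hpos))).exists
    exact lt_asymm h1 h2
  refine ⟨Γ', hmem, hpot, ?_⟩
  set M := rotationOrbit Γ' with hM
  rw [tendsto_infDist_zero_iff ⟨Γ', self_mem_rotationOrbit Γ'⟩]
  obtain ⟨δ₀, hδ₀, hdisj⟩ := (disjoint_sdiff_right :
    Disjoint M (equilibriumSet (undirectedRing n) \ M)).exists_thickenings
    (isCompact_rotationOrbit hn hmem) (isCompact_equilibriumSet_diff_rotationOrbit hn hodd
      hmem).isClosed
  intro δ' hδ'
  set δ := min δ' δ₀ with hδ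
  have hδ0 : 0 < δ := lt_min hδ' hδ₀
  have hdisj' : Disjoint (Metric.thickening δ M)
      (Metric.thickening δ (equilibriumSet (undirectedRing n) \ M)) :=
    hdisj.mono (Metric.thickening_mono (min_le_right _ _) _)
      (Metric.thickening_mono (min_le_right _ _) _)
  obtain ⟨T, hT⟩ := (((tendsto_infDist_zero_iff hne).1 hlim δ hδ0).and
    (eventually_ge_atTop 0)).exists_forall_of_atTop
  have hMD : M ⊆ equilibriumSet (undirectedRing n) := by
    rw [hM, rotationOrbit_eq_fibre hn hmem]; exact inter_subset_left
  have hpre : IsPreconnected (Γ '' Ici T) := (isPreconnected_Ici).image _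
    (h.continuousOn.mono fun t ht => (hT t ht).2)
  have hsub : Γ '' Ici T ⊆ Metric.thickening δ M ∪
      Metric.thickening δ (equilibriumSet (undirectedRing n) \ M) := by
    rintro _ ⟨t, ht, rfl⟩
    rw [← Metric.thickening_union, union_sdiff_cancel hMD]
    exact (hT t ht).1
  have hmeet : (Γ '' Ici T ∩ Metric.thickening δ M).Nonempty := by
    obtain ⟨t, ht, hTt⟩ := ((hfreq _ (Metric.isOpen_thickening.mem_nhds
      (Metric.self_subset_thickening hδ0 M (self_mem_rotationOrbit Γ')))).and_eventually
      (eventually_ge_atTop T)).exists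
    exact ⟨Γ t, mem_image_of_mem _ hTt, ht⟩
  have hall := hpre.subset_left_of_subset_union Metric.isOpen_thickening Metric.isOpen_thickening
    hdisj' hsub hmeet
  filter_upwards [eventually_ge_atTop T] with t ht
  exact Metric.thickening_mono (min_le_left _ _) _ (hall (mem_image_of_mem _ ht))

end Dynamics

/-! ### Descent directions of the potential -/

section Descent

variable {n : ℕ}

/-- Each agent moves along the great circle with initial direction `w i` at speed `y i`. -/
noncomputable def perturb (Γ w : State n) (h : ∀ i, inner ℝ (Γ i : E3) (w i : E3) = 0)
    (y : Fin n → ℝ) (t : ℝ) : State n := fun i =>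
  unitOf (cos (t * y i) • (Γ i : E3) + sin (t * y i) • (w i : E3)) (by
    have h' : inner ℝ (w i : E3) (Γ i : E3) = 0 := by rw [real_inner_comm]; exact h i
    rw [inner_add_left, inner_add_right, inner_add_right]
    simp only [inner_smul_left, inner_smul_right, inner_self_sphere, h, h']
    have h3 := Real.sin_sq_add_cos_sq (t * y i)
    simp
    linear_combination h3)

theorem perturb_zero (Γ w : State n) (h : ∀ i, inner ℝ (Γ i : E3) (w i : E3) = 0)
    (y : Fin n → ℝ) : perturb Γ w h y 0 = Γ := by
  funext i
  apply Subtype.ext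
  simp [perturb, unitOf]

theorem continuous_perturb (Γ w : State n) (h : ∀ i, inner ℝ (Γ i : E3) (w i : E3) = 0)
    (y : Fin n → ℝ) : Continuous (perturb Γ w h y) := by
  refine continuous_pi fun i => Continuous.subtype_mk ?_ _
  fun_prop

theorem exists_pos_or_const {g : Fin n → ℝ} (hg : ∀ i j, g i ^ 2 = g j ^ 2) :
    (∃ e, 0 < g e) ∨ ∀ i j, g i = g j := by
  by_cases h : ∃ e, 0 < g e
  · exact Or.inl h
  · push Not at h
    refine Or.inr fun i j => ?_
    have := (sq_eq_sq₀ (neg_nonneg.2 (h i)) (neg_nonneg.2 (h j))).1 (by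
      rw [neg_sq, neg_sq, hg i j])
    linarith

variable [NeZero n]

/-- Adding the states at t and -t cancels the odd terms. Squared sines of multiples of t make the
limit after division by t² immediate. -/
theorem edgeCos_perturb_add (Γ w : State n) (h : ∀ i, inner ℝ (Γ i : E3) (w i : E3) = 0)
    (y : Fin n → ℝ) (t : ℝ) (i : Fin n) :
    edgeCos (perturb Γ w h y t) i + edgeCos (perturb Γ w h y (-t)) i - 2 * edgeCos Γ i =
      2 * (-edgeCos Γ i * (sin ((y i + y (i + 1)) / 2 * t) ^ 2 +
          sin ((y i - y (i + 1)) / 2 * t) ^ 2) +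
        inner ℝ (w i : E3) (w (i + 1) : E3) * (sin ((y i + y (i + 1)) / 2 * t) ^ 2 -
          sin ((y i - y (i + 1)) / 2 * t) ^ 2)) := by
  have hp : cos (t * y i) * cos (t * y (i + 1)) = 1 - (sin ((y i + y (i + 1)) / 2 * t) ^ 2 +
      sin ((y i - y (i + 1)) / 2 * t) ^ 2) := by
    rw [Real.sin_sq_eq_half_sub, Real.sin_sq_eq_half_sub,
      show 2 * ((y i + y (i + 1)) / 2 * t) = t * y i + t * y (i + 1) by ring,
      show 2 * ((y i - y (i + 1)) / 2 * t) = t * y i - t * y (i + 1) by ring,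
      Real.cos_add, Real.cos_sub]
    ring
  have hm : sin (t * y i) * sin (t * y (i + 1)) = sin ((y i + y (i + 1)) / 2 * t) ^ 2 -
      sin ((y i - y (i + 1)) / 2 * t) ^ 2 := by
    rw [Real.sin_sq_eq_half_sub, Real.sin_sq_eq_half_sub,
      show 2 * ((y i + y (i + 1)) / 2 * t) = t * y i + t * y (i + 1) by ring,
      show 2 * ((y i - y (i + 1)) / 2 * t) = t * y i - t * y (i + 1) by ring,
      Real.cos_add, Real.cos_sub]
    ring
  rw [← hm, show sin ((y i + y (i + 1)) / 2 * t) ^ 2 + sin ((y i - y (i + 1)) / 2 * t) ^ 2 =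
    1 - cos (t * y i) * cos (t * y (i + 1)) by linarith]
  simp only [edgeCos, perturb, unitOf, inner_add_left, inner_add_right, inner_smul_left,
    inner_smul_right, neg_mul, Real.cos_neg, Real.sin_neg]
  simp
  ring

theorem tendsto_sin_mul_div (c : ℝ) :
    Tendsto (fun t => sin (c * t) / t) (𝓝[>] 0) (𝓝 c) := by
  have hd : HasDerivAt (fun t => sin (c * t)) c 0 := by
    have := ((hasDerivAt_id (0 : ℝ)).const_mul c).sin
    simpa using this
  have h := (hasDerivAt_iff_tendsto_slope_zero.1 hd).mono_left
    (nhdsWithin_mono 0 fun t (ht : 0 < t) => ht.ne')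
  refine h.congr fun t => ?_
  simp [div_eq_inv_mul]

/-- The form is the limit of the symmetric second difference quotient of V. If it is negative, then
for small t one of the perturbations at t and -t lies below V(Γ). -/
theorem exists_potential_lt_of_form_neg (Γ w : State n)
    (h : ∀ i, inner ℝ (Γ i : E3) (w i : E3) = 0) (y : Fin n → ℝ)
    (hq : ∑ i, (2 * inner ℝ (w i : E3) (w (i + 1) : E3) * (y i * y (i + 1)) -
      edgeCos Γ i * (y i ^ 2 + y (i + 1) ^ 2)) < 0) {ε : ℝ} (hε : 0 < ε) :
    ∃ Γ', dist Γ' Γ < ε ∧ potential Γ' < potential Γ := by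
  set p := perturb Γ w h y with hp
  have hlim : Tendsto (fun t => (potential (p t) + potential (p (-t)) - 2 * potential Γ) / t ^ 2)
      (𝓝[>] 0) (𝓝 (∑ i, (2 * inner ℝ (w i : E3) (w (i + 1) : E3) * (y i * y (i + 1)) -
      edgeCos Γ i * (y i ^ 2 + y (i + 1) ^ 2)))) := by
    have hterm : ∀ i, Tendsto (fun t => 2 * (-edgeCos Γ i *
          ((sin ((y i + y (i + 1)) / 2 * t) / t) ^ 2 + (sin ((y i - y (i + 1)) / 2 * t) / t) ^ 2) +
        inner ℝ (w i : E3) (w (i + 1) : E3) * ((sin ((y i + y (i + 1)) / 2 * t) / t) ^ 2 -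
          (sin ((y i - y (i + 1)) / 2 * t) / t) ^ 2))) (𝓝[>] 0)
        (𝓝 (2 * inner ℝ (w i : E3) (w (i + 1) : E3) * (y i * y (i + 1)) -
          edgeCos Γ i * (y i ^ 2 + y (i + 1) ^ 2))) := by
      intro i
      have h1 := (tendsto_sin_mul_div ((y i + y (i + 1)) / 2)).pow 2
      have h2 := (tendsto_sin_mul_div ((y i - y (i + 1)) / 2)).pow 2
      have h3 := (((h1.add h2).const_mul (-edgeCos Γ i)).add
        ((h1.sub h2).const_mul (inner ℝ (w i : E3) (w (i + 1) : E3)))).const_mul 2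
      convert h3 using 2
      ring
    refine (tendsto_finsetSum Finset.univ fun i _ => hterm i).congr fun t => ?_
    simp only [potential]
    rw [Finset.mul_sum, ← Finset.sum_add_distrib, ← Finset.sum_sub_distrib, Finset.sum_div]
    refine Finset.sum_congr rfl fun i _ => ?_
    rw [edgeCos_perturb_add]
    simp only [div_pow]
    ring
  have hcont := continuous_perturb Γ w h y
  have hnear : ∀ᶠ t in 𝓝 (0 : ℝ), dist (p t) Γ < ε := by
    have : Tendsto p (𝓝 0) (𝓝 Γ) := by
      simpa [hp, perturb_zero] using hcont.tendsto 0
    exact this.eventually (Metric.ball_mem_nhds Γ hε)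
  have hnear' : ∀ᶠ t in 𝓝 (0 : ℝ), dist (p (-t)) Γ < ε := by
    have h0 : Tendsto (fun t : ℝ => -t) (𝓝 0) (𝓝 0) := by simpa using (tendsto_id (x := 𝓝 (0:ℝ))).neg
    exact h0.eventually hnear
  obtain ⟨t, ⟨⟨hneg, h1⟩, h2⟩, ht⟩ := (((hlim.eventually_lt_const hq).and
    (hnear.filter_mono nhdsWithin_le_nhds)).and
    (hnear'.filter_mono nhdsWithin_le_nhds)).and self_mem_nhdsWithin |>.exists
  have hsum : potential (p t) + potential (p (-t)) - 2 * potential Γ < 0 := by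
    by_contra! hnn
    exact absurd hneg (not_lt.2 (div_nonneg hnn (sq_nonneg t)))
  rcases lt_or_ge (potential (p t)) (potential Γ) with hlt | hge
  · exact ⟨_, h1, hlt⟩
  · exact ⟨_, h2, by linarith⟩

theorem val_add_one_of_ne {k : Fin n} (h : k + 1 ≠ 0) : ((k + 1 : Fin n) : ℕ) = (k : ℕ) + 1 := by
  have hk := k.2
  rw [Fin.val_add, Fin.val_one', Nat.add_mod_mod]
  refine Nat.mod_eq_of_lt (lt_of_le_of_ne hk fun he => h (Fin.ext ?_))
  rw [Fin.val_add, Fin.val_one', Nat.add_mod_mod]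
  simp [he]

theorem val_of_add_one_eq_zero {k : Fin n} (h : k + 1 = 0) : (k : ℕ) + 1 = n := by
  have h1 := congrArg Fin.val h
  rw [Fin.val_add, Fin.val_one', Nat.add_mod_mod] at h1
  have hk := k.2
  by_contra hne
  rw [Nat.mod_eq_of_lt (by omega)] at h1
  simp at h1

/-- Number the agents from e + 1 onwards: the witness changes by 1 across every edge except e, where
it jumps by n - 1. As the other weights are at least -g_e, the form is at least g_e (n - 1)(n - 2).
-/
theorem exists_pos_edge_form (hn : 3 ≤ n) {g : Fin n → ℝ} {e : Fin n} (he : 0 < g e)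
    (hg : ∀ i, g i ^ 2 = g e ^ 2) : ∃ x : Fin n → ℝ, 0 < ∑ i, g i * (x i - x (i + 1)) ^ 2 := by
  refine ⟨fun i => ((i - (e + 1) : Fin n) : ℕ), ?_⟩
  have hn' : (3 : ℝ) ≤ n := by exact_mod_cast hn
  have hstep : ∀ i, i + 1 - (e + 1) = (i - (e + 1)) + 1 := fun i => by abel
  have hne : ∀ i ∈ Finset.univ.erase e, -g e ≤ g i *
      ((((i - (e + 1) : Fin n) : ℕ) : ℝ) - ((i + 1 - (e + 1) : Fin n) : ℕ)) ^ 2 := by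
    intro i hi
    have hk : (i - (e + 1)) + 1 ≠ 0 := by
      rw [← hstep, add_sub_add_right_eq_sub, sub_ne_zero]
      exact Finset.ne_of_mem_erase hi
    rw [hstep, val_add_one_of_ne hk]
    push_cast
    have : -g e ≤ g i := neg_le_of_abs_le (abs_le_of_sq_le_sq (hg i).le he.le)
    simpa using this
  have hself : ((((e - (e + 1) : Fin n) : ℕ) : ℝ) - ((e + 1 - (e + 1) : Fin n) : ℕ)) = n - 1 := by
    have hk : (e - (e + 1)) + 1 = 0 := by abel
    have := val_of_add_one_eq_zero hk
    rw [sub_self, eq_sub_iff_add_eq, Fin.val_zero]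
    push_cast
    rw [sub_zero]
    exact_mod_cast this
  rw [← Finset.add_sum_erase _ _ (Finset.mem_univ e)]
  simp only [hself]
  have hsum := Finset.card_nsmul_le_sum _ _ _ hne
  rw [Finset.card_erase_of_mem (Finset.mem_univ e), Finset.card_univ, Fintype.card_fin,
    nsmul_eq_mul, Nat.cast_sub (by omega)] at hsum
  push_cast at hsum
  nlinarith [mul_pos he (show (0 : ℝ) < (n - 1) * (n - 2) by nlinarith)]

theorem cos_lt_of_edgeCos_const (hn : 3 ≤ n) (hodd : Odd n) {Γ : State n}
    (h : Γ ∉ cyclicFormation n) {c : ℝ} (hc : ∀ i, edgeCos Γ i = c) : cos (π - π / n) < c := by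
  have h1 : potential Γ = n * c := by simp [potential, hc]
  have h2 := lt_of_le_of_ne (le_potential hodd Γ)
    fun h0 => h ((mem_cyclicFormation_iff_potential hn hodd).2 h0.symm)
  rw [h1] at h2
  exact lt_of_mul_lt_mul_left h2 (Nat.cast_nonneg n)

theorem exists_potential_lt (hn : 3 ≤ n) (hodd : Odd n) {Γ : State n}
    (h : Γ ∈ equilibriumSet (undirectedRing n)) (hc : Γ ∉ cyclicFormation n) {ε : ℝ}
    (hε : 0 < ε) : ∃ Γ', dist Γ' Γ < ε ∧ potential Γ' < potential Γ := by
  obtain ⟨u, hu⟩ := exists_normal hn h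
  have hu' : ∀ i, inner ℝ (Γ i : E3) (u : E3) = 0 := fun i => by rw [real_inner_comm]; exact hu i
  rcases exists_pos_or_const (edgeCos_sq_const hn h) with ⟨e, he⟩ | hconst
  -- Motion along the great circle: with directions u × Γ_i the second variation is minus the edge
  -- form.
  · obtain ⟨y, hy⟩ := exists_pos_edge_form hn he fun i => edgeCos_sq_const hn h i e
    have hunit : ∀ i, inner ℝ (cross (u : E3) (Γ i)) (cross (u : E3) (Γ i)) = 1 := fun i => by
      rw [inner_cross_cross, inner_self_sphere, inner_self_sphere, hu]; simp
    refine exists_potential_lt_of_form_neg Γ (fun i => unitOf _ (hunit i))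
      (fun i => inner_cross_right _ _) y ?_ hε
    rw [← neg_pos, ← Finset.sum_neg_distrib]
    refine hy.trans_eq (Finset.sum_congr rfl fun i _ => ?_)
    have : inner ℝ (unitOf _ (hunit i) : E3) (unitOf _ (hunit (i + 1)) : E3) = edgeCos Γ i := by
      simp only [unitOf]
      rw [inner_cross_cross, inner_self_sphere, hu, edgeCos]; ring
    rw [this]
    ring
  · have hlt := cos_lt_of_edgeCos_const hn hodd hc fun i => hconst i 0
    -- Motion normal to the great circle, with amplitudes forming a ring eigenvector of neighbour
    -- sum 2 cos(π - π/n); the form is 2(cos(π - π/n) - c) ∑ y_i², where c is the common edge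
    -- cosine.
    refine exists_potential_lt_of_form_neg Γ (fun _ => u) hu'
      (fun i => cos ((i : ℕ) * (π - π / n))) ?_ hε
    simp only [inner_self_sphere, hconst _ 0]
    set y : Fin n → ℝ := fun i => cos ((i : ℕ) * (π - π / n)) with hy
    change ∑ i, (2 * 1 * (y i * y (i + 1)) - edgeCos Γ 0 * (y i ^ 2 + y (i + 1) ^ 2)) < 0
    have h1 : ∑ i, y i * y (i + 1) = cos (π - π / n) * ∑ i, y i ^ 2 := by
      have h2 : ∑ i, y i * y (i - 1) = ∑ i, y i * y (i + 1) := by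
        rw [← sum_add_one fun i => y i * y (i - 1)]
        simp [mul_comm]
      have h3 : ∑ i, y i * (y (i - 1) + y (i + 1)) = 2 * cos (π - π / n) * ∑ i, y i ^ 2 := by
        rw [Finset.mul_sum]
        refine Finset.sum_congr rfl fun i _ => ?_
        have := cos_neighbours hodd i
        simp only [hy]
        rw [this]
        ring
      simp only [mul_add, Finset.sum_add_distrib] at h3
      linarith
    have h4 := sum_add_one fun i => y i ^ 2
    have hpos : 0 < ∑ i, y i ^ 2 :=
      Finset.sum_pos' (fun _ _ => sq_nonneg _) ⟨0, Finset.mem_univ _, by simp [hy]⟩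
    rw [Finset.sum_sub_distrib, ← Finset.mul_sum, ← Finset.mul_sum, Finset.sum_add_distrib, h4, h1]
    nlinarith

/-! ### Stability and instability -/

/-- S may be any set between {Γ} and its orbit, which covers both the single equilibrium and its
manifold. A start of lower potential near Γ leads to another orbit, away from a fixed thickening of
this one. -/
theorem not_isStable (hn : 3 ≤ n) (hodd : Odd n) {Γ : State n}
    (h : Γ ∈ equilibriumSet (undirectedRing n)) (hc : Γ ∉ cyclicFormation n)
    {S : Set (State n)} (hΓS : Γ ∈ S) (hS : S ⊆ rotationOrbit Γ) :
    ¬ IsStable (undirectedRing n) S := by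
  intro hst
  have hSne : S.Nonempty := ⟨Γ, hΓS⟩
  set M := rotationOrbit Γ with hM
  obtain ⟨ε, hε, hdisj⟩ := (disjoint_sdiff_right :
    Disjoint M (equilibriumSet (undirectedRing n) \ M)).exists_thickenings
    (isCompact_rotationOrbit hn h) (isCompact_equilibriumSet_diff_rotationOrbit hn hodd h).isClosed
  obtain ⟨δ, hδ, hstab⟩ := hst ε hε
  have hp := Real.pi_pos
  -- The geodesic set distance is at most π/2 times the chordal one, so chordal distance below δ/π
  -- suffices.
  obtain ⟨Γ₀, hd, hlt⟩ := exists_potential_lt hn hodd h hc (ε := δ / π) (by positivity)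
  obtain ⟨Γt, ht, h0⟩ := exists_trajectory hn Γ₀
  have hin := hstab Γt ht (by
    rw [h0]
    have h1 := setDist_le_infDist hSne Γ₀
    have h2 := Metric.infDist_le_dist_of_mem (x := Γ₀) hΓS
    rw [lt_div_iff₀ hp] at hd
    nlinarith [Metric.infDist_nonneg (x := Γ₀) (s := S), dist_nonneg (x := Γ₀) (y := Γ)])
  obtain ⟨Γ', hΓ', hpot, hlim⟩ := ht.exists_limit_orbit hn hodd
  have hne : ∀ x ∈ rotationOrbit Γ', x ∉ M := fun x hx hx' => by
    have h1 := potential_eq_of_mem_rotationOrbit hx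
    have h2 := potential_eq_of_mem_rotationOrbit hx'
    rw [h0] at hpot
    linarith
  have hsub : rotationOrbit Γ' ⊆ equilibriumSet (undirectedRing n) \ M := fun x hx =>
    ⟨mem_equilibriumSet_of_mem_rotationOrbit hn hΓ' hx, hne x hx⟩
  obtain ⟨t, h1, h2⟩ := (((tendsto_infDist_zero_iff ⟨Γ', self_mem_rotationOrbit Γ'⟩).1 hlim ε
    hε).and (eventually_ge_atTop 0)).exists
  refine disjoint_left.1 hdisj ?_ (Metric.thickening_subset_of_subset ε hsub h1)
  exact Metric.thickening_subset_of_subset ε hS ((Metric.mem_thickening_iff_infDist_lt hSne).2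
    ((infDist_le_setDist hSne _).trans_lt (hin t h2)))

/-- On K the potential is bounded below by some c above its minimum, and a thickening of the
formation lies in {V < c}. Taking K far from the formation gives stability; taking the other
equilibria gives attraction. -/
theorem exists_sublevel_avoiding (hn : 3 ≤ n) (hodd : Odd n) {K : Set (State n)}
    (hK : IsCompact K) (hdisj : ∀ Γ ∈ K, Γ ∉ cyclicFormation n) :
    ∃ δ : ℝ, 0 < δ ∧ ∀ Γ Γ' : State n, setDist (cyclicFormation n) Γ < δ →
      potential Γ' ≤ potential Γ → Γ' ∉ K := by
  obtain ⟨c, hc, hcK⟩ := hK.exists_forall_le' (continuous_potential.continuousOn)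
    (a := n * cos (π - π / n)) fun Γ hΓ => lt_of_le_of_ne (le_potential hodd Γ) fun h0 =>
      hdisj Γ hΓ ((mem_cyclicFormation_iff_potential hn hodd).2 h0.symm)
  obtain ⟨Γ₀, h₀⟩ := cyclicFormation_nonempty (n := n)
  have hcomp : IsCompact (cyclicFormation n) := by
    rw [cyclicFormation_eq_rotationOrbit hn hodd h₀]
    exact isCompact_rotationOrbit hn (cyclicFormation_subset_equilibriumSet hn hodd h₀)
  obtain ⟨δ, hδ, hsub⟩ := hcomp.exists_thickening_subset_open
    (isOpen_lt continuous_potential continuous_const : IsOpen {Γ : State n | potential Γ < c})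
    fun Γ hΓ => by
      change potential Γ < c
      rwa [potential_of_mem_cyclicFormation hodd hΓ]
  refine ⟨δ, hδ, fun Γ Γ' hΓ hle hmem => ?_⟩
  have h1 : potential Γ < c := hsub ((Metric.mem_thickening_iff_infDist_lt ⟨Γ₀, h₀⟩).2
    ((infDist_le_setDist ⟨Γ₀, h₀⟩ Γ).trans_lt hΓ))
  exact absurd (hcK Γ' hmem) (not_le.2 (hle.trans_lt h1))

theorem isAsymptoticallyStable_cyclicFormation (hn : 3 ≤ n) (hodd : Odd n) :
    IsAsymptoticallyStable (undirectedRing n) (cyclicFormation n) := by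
  have hne := cyclicFormation_nonempty (n := n)
  constructor
  · intro ε hε
    have hp := Real.pi_pos
    obtain ⟨δ, hδ, H⟩ := exists_sublevel_avoiding hn hodd
      (K := {Γ : State n | ε / π ≤ Metric.infDist Γ (cyclicFormation n)})
      (isClosed_le continuous_const (Metric.continuous_infDist_pt _)).isCompact
      fun Γ hΓ hmem => by
        have h1 : ε / π ≤ Metric.infDist Γ (cyclicFormation n) := hΓ
        rw [Metric.infDist_zero_of_mem hmem] at h1
        exact absurd h1 (not_le.2 (by positivity))
    refine ⟨δ, hδ, fun Γ hΓ h0 t ht => ?_⟩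
    have h1 := H (Γ 0) (Γ t) h0 (hΓ.potential_antitone hn le_rfl ht)
    have h2 : Metric.infDist (Γ t) (cyclicFormation n) < ε / π := not_le.1 h1
    have h3 := setDist_le_infDist hne (Γ t)
    rw [lt_div_iff₀ hp] at h2
    nlinarith
  · obtain ⟨Γ₀, h₀⟩ := hne
    have hK := isCompact_equilibriumSet_diff_rotationOrbit hn hodd
      (cyclicFormation_subset_equilibriumSet hn hodd h₀)
    rw [← cyclicFormation_eq_rotationOrbit hn hodd h₀] at hK
    obtain ⟨δ, hδ, H⟩ := exists_sublevel_avoiding hn hodd hK fun Γ hΓ => hΓ.2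
    refine ⟨δ, hδ, fun Γ hΓ h0 => ?_⟩
    obtain ⟨Γ', hΓ', hpot, hlim⟩ := hΓ.exists_limit_orbit hn hodd
    have hmem : Γ' ∈ cyclicFormation n := by
      by_contra hnot
      exact H (Γ 0) Γ' h0 hpot ⟨hΓ', hnot⟩
    rw [approaches_iff ⟨Γ₀, h₀⟩, cyclicFormation_eq_rotationOrbit hn hodd hmem]
    exact hlim

end Descent

/-! ### The linearization in spherical coordinates -/

theorem hasDerivAt_update_apply {n : ℕ} (x : Fin n → ℝ) (j k : Fin n) (s : ℝ) :
    HasDerivAt (fun s => Function.update x j s k) (if j = k then 1 else 0) s := by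
  have := hasDerivAt_pi.1 (hasDerivAt_update x j s) k
  simpa [Pi.single_apply, eq_comm] using this

section Linearization

variable {n : ℕ} [NeZero n]

theorem psiJacobian_apply (hn : 3 ≤ n) (ψ : Fin n → ℝ) (i j : Fin n) :
    psiJacobian (undirectedRing n) ψ i j =
      -(cos (ψ (i - 1) - ψ i) * ((if j = i - 1 then 1 else 0) - if j = i then 1 else 0) +
        cos (ψ (i + 1) - ψ i) * ((if j = i + 1 then 1 else 0) - if j = i then 1 else 0)) := by
  have hfun : (fun s => psiField (undirectedRing n) (Function.update ψ j s) 0 i) = fun s =>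
      -(sin (Function.update ψ j s (i - 1) - Function.update ψ j s i) +
        sin (Function.update ψ j s (i + 1) - Function.update ψ j s i)) := by
    funext s
    simp only [psiField, sum_undirectedRing hn]
    simp
  have hd := (((hasDerivAt_update_apply ψ j (i - 1) (ψ j)).sub
    (hasDerivAt_update_apply ψ j i (ψ j))).sin.add
    ((hasDerivAt_update_apply ψ j (i + 1) (ψ j)).sub
    (hasDerivAt_update_apply ψ j i (ψ j))).sin).neg
  rw [psiJacobian, Matrix.of_apply, hfun]
  refine hd.deriv.trans ?_
  simp [Function.update_eq_self]

/-- The Jacobian is a weighted Laplacian of the ring with the edge cosines as weights, so its form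
is the one treated in `exists_pos_edge_form`. -/
theorem dotProduct_psiJacobian_mulVec (hn : 3 ≤ n) (ψ x : Fin n → ℝ) :
    x ⬝ᵥ (psiJacobian (undirectedRing n) ψ).mulVec x =
      ∑ i, cos (ψ i - ψ (i + 1)) * (x i - x (i + 1)) ^ 2 := by
  have hmul : ∀ i, (psiJacobian (undirectedRing n) ψ).mulVec x i =
      cos (ψ (i - 1) - ψ i) * (x i - x (i - 1)) + cos (ψ i - ψ (i + 1)) * (x i - x (i + 1)) := by
    intro i
    rw [← Real.cos_neg (ψ i - ψ (i + 1)), neg_sub]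
    simp only [Matrix.mulVec, dotProduct, psiJacobian_apply hn]
    simp only [neg_mul, add_mul, mul_assoc, sub_mul, ite_mul, one_mul, zero_mul,
      Finset.sum_neg_distrib, Finset.sum_add_distrib, ← Finset.mul_sum, Finset.sum_sub_distrib,
      Finset.sum_ite_eq', Finset.mem_univ, if_true]
    ring
  have hshift : ∑ i, x i * (cos (ψ (i - 1) - ψ i) * (x i - x (i - 1))) =
      ∑ i, x (i + 1) * (cos (ψ i - ψ (i + 1)) * (x (i + 1) - x i)) := by
    rw [← sum_add_one fun i => x i * (cos (ψ (i - 1) - ψ i) * (x i - x (i - 1)))]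
    simp
  simp only [dotProduct, hmul, mul_add, Finset.sum_add_distrib]
  rw [hshift, ← Finset.sum_add_distrib]
  exact Finset.sum_congr rfl fun i _ => by ring

theorem phiJacobian_eq_ringMatrix (hn : 3 ≤ n) {ψ : Fin n → ℝ} {c : ℝ}
    (h : ∀ i, cos (ψ i - ψ (i + 1)) = c) :
    phiJacobian (undirectedRing n) ψ = ringMatrix (2 * c) (-1) := by
  ext i j
  have h1 : cos (ψ i - ψ (i - 1)) = c := by
    have := h (i - 1)
    rwa [sub_add_cancel, ← Real.cos_neg, neg_sub] at this
  have hfun : (fun s => phiField (undirectedRing n) ψ (Function.update 0 j s) i) = fun s =>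
      (sin (Function.update (0 : Fin n → ℝ) j s i) *
          cos (Function.update (0 : Fin n → ℝ) j s (i - 1)) * c -
        cos (Function.update (0 : Fin n → ℝ) j s i) *
          sin (Function.update (0 : Fin n → ℝ) j s (i - 1))) +
      (sin (Function.update (0 : Fin n → ℝ) j s i) *
          cos (Function.update (0 : Fin n → ℝ) j s (i + 1)) * c -
        cos (Function.update (0 : Fin n → ℝ) j s i) *
          sin (Function.update (0 : Fin n → ℝ) j s (i + 1))) := by
    funext s
    simp only [phiField, sum_undirectedRing hn, h1, h i]
  have hu := hasDerivAt_update_apply (0 : Fin n → ℝ) j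
  have hterm : ∀ k, HasDerivAt (fun s => sin (Function.update (0 : Fin n → ℝ) j s i) *
          cos (Function.update (0 : Fin n → ℝ) j s k) * c -
        cos (Function.update (0 : Fin n → ℝ) j s i) *
          sin (Function.update (0 : Fin n → ℝ) j s k))
      ((if j = i then c else 0) - if j = k then 1 else 0) 0 := by
    intro k
    have hz : ∀ k, Function.update (0 : Fin n → ℝ) j 0 k = 0 := fun k => by
      simp [Function.update_apply]
    refine ((((hu i 0).sin.mul (hu k 0).cos).mul_const c).sub
      ((hu i 0).cos.mul (hu k 0).sin)).congr_deriv ?_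
    simp [hz]
  rw [phiJacobian, Matrix.of_apply, hfun]
  refine ((hterm (i - 1)).add (hterm (i + 1))).deriv.trans ?_
  simp only [ringMatrix, Matrix.of_apply]
  split_ifs <;> ring

end Linearization

end RingFormation

/-! ### Assembly of the main theorem. -/

theorem mainTheorem5 (n : ℕ) [NeZero n] (hn : 2 ≤ n) (hodd : Odd n) :
    -- every trajectory approaches one of the equilibrium manifolds
    (∀ Γ : ℝ → State n, IsTrajectory (undirectedRing n) Γ →
      ∃ M : Set (State n), IsEquilibriumManifold (undirectedRing n) M ∧ Approaches Γ M) ∧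
    -- each equilibrium manifold is a single orbit of SO(3)
    (∀ M : Set (State n), IsEquilibriumManifold (undirectedRing n) M →
      ∀ Γ ∈ M, M = rotationOrbit Γ) ∧
    -- the cyclic formation manifold is one of them, it is (asymptotically) stable ...
    IsEquilibriumManifold (undirectedRing n) (cyclicFormation n) ∧
    IsAsymptoticallyStable (undirectedRing n) (cyclicFormation n) ∧
    -- ... and every other equilibrium manifold is unstable
    (∀ M : Set (State n), IsEquilibriumManifold (undirectedRing n) M → M ≠ cyclicFormation n →
      ¬ IsStable (undirectedRing n) M) ∧
    -- every equilibrium outside the cyclic formation manifold ...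
    (∀ Γ ∈ equilibriumSet (undirectedRing n) \ cyclicFormation n,
      -- ... is itself unstable,
      ¬ IsStable (undirectedRing n) {Γ} ∧
      -- ... lies on a great circle,
      (∃ (R : Matrix (Fin 3) (Fin 3) ℝ) (ψ : Fin n → ℝ), RotatesToEquator R Γ ψ) ∧
      -- ... and in coordinates in which this circle is the equator:
      (∀ (R : Matrix (Fin 3) (Fin 3) ℝ) (ψ : Fin n → ℝ), RotatesToEquator R Γ ψ →
        -- neighbouring distances not all equal: a positive value of the ψ-quadratic form
        ((¬ ∃ α : ℝ, ∀ i, geoDist (Γ i) (Γ (i + 1)) = α) →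
          ∃ x : Fin n → ℝ, 0 < x ⬝ᵥ (psiJacobian (undirectedRing n) ψ).mulVec x) ∧
        -- neighbouring distances all equal: the eigenvalues of the φ-Jacobian, one positive
        (∀ α : ℝ, (∀ i, geoDist (Γ i) (Γ (i + 1)) = α) →
          (phiJacobian (undirectedRing n) ψ).charpoly =
            ∏ l : Fin n, (X - C (2 * (cos α - cos (((l : ℕ) : ℝ) * (2 * π / n))))) ∧
          0 < 2 * (cos α - cos (π - π / n))))) := by
  have hn3 : 3 ≤ n := by
    obtain ⟨m, rfl⟩ := hodd
    omega
  refine ⟨fun Γ hΓ => ?_, fun M hM Γ hΓ => hM.eq_rotationOrbit hn3 hodd hΓ,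
    isEquilibriumManifold_cyclicFormation hn3 hodd,
    isAsymptoticallyStable_cyclicFormation hn3 hodd, fun M hM hne => ?_, fun Γ hΓ => ?_⟩
  · obtain ⟨Γ', hΓ', -, hlim⟩ := hΓ.exists_limit_orbit hn3 hodd
    exact ⟨_, isEquilibriumManifold_rotationOrbit hn3 hodd hΓ',
      (approaches_iff ⟨Γ', self_mem_rotationOrbit Γ'⟩ Γ).2 hlim⟩
  · obtain ⟨Γ, hΓ, rfl⟩ := hM
    rw [connectedComponentIn_eq_rotationOrbit hn3 hodd hΓ] at hne ⊢
    refine not_isStable hn3 hodd hΓ (fun hc => hne ?_) (self_mem_rotationOrbit Γ) Subset.rfl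
    exact (cyclicFormation_eq_rotationOrbit hn3 hodd hc).symm
  · obtain ⟨hΓ, hc⟩ := hΓ
    obtain ⟨u, hu⟩ := exists_normal hn3 hΓ
    refine ⟨not_isStable hn3 hodd hΓ hc rfl (singleton_subset_iff.2 (self_mem_rotationOrbit Γ)),
      exists_rotatesToEquator hu, fun R ψ hR => ?_⟩
    have hcos : ∀ i, cos (ψ i - ψ (i + 1)) = edgeCos Γ i := fun i =>
      (inner_of_rotatesToEquator hR i (i + 1)).symm
    refine ⟨fun hne => ?_, fun α hα => ?_⟩
    · rcases exists_pos_or_const (edgeCos_sq_const hn3 hΓ) with ⟨e, he⟩ | hconst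
      · obtain ⟨x, hx⟩ := exists_pos_edge_form hn3 he fun i => edgeCos_sq_const hn3 hΓ i e
        refine ⟨x, ?_⟩
        rw [dotProduct_psiJacobian_mulVec hn3]
        simpa only [hcos] using hx
      -- With no positive edge cosine, equal squares force all edge cosines, and hence all
      -- distances, to be equal.
      · exact absurd ⟨arccos (edgeCos Γ 0), fun i => congrArg arccos (hconst i 0)⟩ hne
    · have hedge : ∀ i, edgeCos Γ i = cos α := fun i => by
        rw [← hα i, cos_geoDist]; rfl
      refine ⟨?_, ?_⟩
      · rw [phiJacobian_eq_ringMatrix hn3 fun i => (hcos i).trans (hedge i), charpoly_ringMatrix]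
        refine Finset.prod_congr rfl fun l _ => ?_
        congr 2
        ring
      · have := cos_lt_of_edgeCos_const hn3 hodd hc hedge
        linarith
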